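/- Let $n\ge 2$, let $\Omega\subseteq\mathbb R^n$ be a convex domain, and let $F$ be a Finsler metric on $\Omega$, i.e. $F(x,y)$ is $C^\infty$ and positive for $x\in\Omega$, $y\neq 0$, positively homogeneous of degree one in $y$, and $(g_{ij})=\big(\tfrac12\,\partial^2F^2/\partial y^i\partial y^j\big)$ is positive definite for $y\ne 0$. Suppose that $F$ is spherically symmetric (every element of $O(n)$ maps $\Omega$ to itself and is an isometry of $F$) and is written as $$F(x,y)=\varphi(|x|,|y|,\langle x,y\rangle)\qquad (x\in\Omega,\ y\ne 0),$$ where $\varphi(r,u,v)$ is $C^\infty$ near every point of $$D=\{(|x|,|y|,\langle x,y\rangle): x\in\Omega,\ x\neq 0,\ y\in\mathbb R^n,\ y\ne 0\}.$$ Suppose moreover that $F$ is projective, i.e. its geodesics (the regular solutions of $\ddot c+2G(c,\dot c)=0$, where $G^i=\tfrac14 g^{il}\big([F^2]_{x^ky^l}y^k-[F^2]_{x^l}\big)$) are straight lines as point sets. Let $\lambda\in\mathbb R$. Then $F$ has constant flag curvature $K=\lambda$ if and only if $\varphi$ satisfies, at every $(r,u,v)\in D$, $$\begin{aligned} 4\lambda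 r\varphi^4\varphi_u+r\varphi_uQ^2-4ru\varphi\varphi_vQ+4u\varphi^2\varphi_r&=0,\\ 4\lambda r\varphi^4\varphi_v+r\varphi_vQ^2+2\varphi^2Q_r-4\varphi\varphi_rQ&=0, \end{aligned}$$ where $Q:=\frac{v}{r}\varphi_r+u^2\varphi_v$. -/

import Mathlib

open scoped ContDiff

noncomputable section

namespace Finsler

/-- Euclidean `n`-space. A point of its tangent bundle is a pair `(x, y)` of vectors. -/
abbrev E (n : ℕ) : Type := EuclideanSpace ℝ (Fin n)

/-- `∂f/∂x^i` of a function `f(x, y)` of position and direction. -/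
def pdx {n : ℕ} (i : Fin n) (f : E n → E n → ℝ) (x y : E n) : ℝ :=
  fderiv ℝ (fun z => f z y) x (EuclideanSpace.single i 1)

/-- `∂f/∂y^i` of a function `f(x, y)` of position and direction. -/
def pdy {n : ℕ} (i : Fin n) (f : E n → E n → ℝ) (x y : E n) : ℝ :=
  fderiv ℝ (fun z => f x z) y (EuclideanSpace.single i 1)

/-- The function `F²`. -/
def sqF {n : ℕ} (F : E n → E n → ℝ) : E n → E n → ℝ := fun x y => F x y ^ 2

/-- The fundamental tensor `g_ij = ½ ∂²F²/∂y^i∂y^j`. -/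
def fundTensor {n : ℕ} (F : E n → E n → ℝ) (x y : E n) : Matrix (Fin n) (Fin n) ℝ :=
  Matrix.of fun i j => (1 / 2) * pdy i (pdy j (sqF F)) x y

/-- `F` is a (positively homogeneous, strongly convex) Finsler metric on `Ω ⊆ ℝⁿ`. -/
structure IsFinslerMetric {n : ℕ} (Ω : Set (E n)) (F : E n → E n → ℝ) : Prop where
  smooth : ContDiffOn ℝ ∞ (fun p : E n × E n => F p.1 p.2) (Ω ×ˢ {0}ᶜ)
  pos : ∀ x ∈ Ω, ∀ y, y ≠ 0 → 0 < F x y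
  homog : ∀ x ∈ Ω, ∀ y, ∀ c : ℝ, 0 < c → F x (c • y) = c * F x y
  posDef : ∀ x ∈ Ω, ∀ y, y ≠ 0 → (fundTensor F x y).PosDef

/-- Every orthogonal transformation is an isometry of `(Ω, F)`. -/
def IsSphericallySymmetric {n : ℕ} (Ω : Set (E n)) (F : E n → E n → ℝ) : Prop :=
  ∀ A : E n ≃ₗᵢ[ℝ] E n, (∀ x ∈ Ω, A x ∈ Ω) ∧ ∀ x ∈ Ω, ∀ y, F (A x) (A y) = F x y

/-- The spray coefficients `G^i = ¼ g^{il} ([F²]_{x^k y^l} y^k - [F²]_{x^l})`. -/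
def spray {n : ℕ} (F : E n → E n → ℝ) (i : Fin n) (x y : E n) : ℝ :=
  (1 / 4) * ∑ l, (fundTensor F x y)⁻¹ i l *
    ((∑ k, pdx k (pdy l (sqF F)) x y * y k) - pdx l (sqF F) x y)

/-- `c` is a (constant speed, regular) geodesic of `(Ω, F)` on the open interval `(a, b)`:
`c'' + 2 G(c, c') = 0`. -/
def IsGeodesicOn {n : ℕ} (Ω : Set (E n)) (F : E n → E n → ℝ) (c : ℝ → E n) (a b : ℝ) : Prop :=
  ContDiffOn ℝ 2 c (Set.Ioo a b) ∧
  ∀ t ∈ Set.Ioo a b, c t ∈ Ω ∧ deriv c t ≠ 0 ∧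
    ∀ i, deriv (deriv c) t i + 2 * spray F i (c t) (deriv c t) = 0

/-- `F` is projective on `Ω`: its geodesics are straight lines (as point sets). -/
def IsProjective {n : ℕ} (Ω : Set (E n)) (F : E n → E n → ℝ) : Prop :=
  ∀ (c : ℝ → E n) (a b : ℝ), IsGeodesicOn Ω F c a b →
    ∃ p w : E n, ∀ t ∈ Set.Ioo a b, ∃ s : ℝ, c t = p + s • w

/-- The Riemann curvature `R^i_k = 2 ∂G^i/∂x^k - y^j ∂²G^i/∂x^j∂y^k + 2 G^j ∂²G^i/∂y^j∂y^k
- ∂G^i/∂y^j ∂G^j/∂y^k`. -/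
def riemann {n : ℕ} (F : E n → E n → ℝ) (i k : Fin n) (x y : E n) : ℝ :=
  2 * pdx k (spray F i) x y
    - ∑ j, y j * pdx j (pdy k (spray F i)) x y
    + 2 * ∑ j, spray F j x y * pdy j (pdy k (spray F i)) x y
    - ∑ j, pdy j (spray F i) x y * pdy k (spray F j) x y

/-- The inner product `g_y(v, w) = g_ij(x, y) v^i w^j`. -/
def gInner {n : ℕ} (F : E n → E n → ℝ) (x y v w : E n) : ℝ :=
  ∑ i, ∑ j, fundTensor F x y i j * v i * w j

/-- The vector `R_y(w)` with components `R^i_k w^k`. -/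
def riemannVec {n : ℕ} (F : E n → E n → ℝ) (x y w : E n) : E n :=
  WithLp.toLp 2 fun i => ∑ k, riemann F i k x y * w k

/-- The flag curvature of the flag spanned by `y, w` with flagpole `y`:
`g_y(R_y(w), w) / (g_y(y, y) g_y(w, w) - g_y(y, w)²)`. -/
def flagCurvature {n : ℕ} (F : E n → E n → ℝ) (x y w : E n) : ℝ :=
  gInner F x y (riemannVec F x y w) w /
    (gInner F x y y y * gInner F x y w w - gInner F x y y w ^ 2)

/-- `(Ω, F)` has constant flag curvature `K = lam`. -/
def HasConstFlagCurvature {n : ℕ} (Ω : Set (E n)) (F : E n → E n → ℝ) (lam : ℝ) : Prop :=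
  ∀ x ∈ Ω, ∀ y w : E n, LinearIndependent ℝ ![y, w] → flagCurvature F x y w = lam

/-- The values `(r, u, v) = (|x|, |y|, ⟨x, y⟩)` for `x ∈ Ω`, `x ≠ 0`, `y ≠ 0`. -/
def ruvDomain {n : ℕ} (Ω : Set (E n)) : Set (ℝ × ℝ × ℝ) :=
  {p | ∃ x ∈ Ω, x ≠ 0 ∧ ∃ y : E n, y ≠ 0 ∧ p = (‖x‖, ‖y‖, inner ℝ x y)}

/-- `∂φ/∂r` of a function `φ(r, u, v)`. -/
def dr (φ : ℝ → ℝ → ℝ → ℝ) (r u v : ℝ) : ℝ := deriv (fun s => φ s u v) r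

/-- `∂φ/∂u` of a function `φ(r, u, v)`. -/
def du (φ : ℝ → ℝ → ℝ → ℝ) (r u v : ℝ) : ℝ := deriv (fun s => φ r s v) u

/-- `∂φ/∂v` of a function `φ(r, u, v)`. -/
def dv (φ : ℝ → ℝ → ℝ → ℝ) (r u v : ℝ) : ℝ := deriv (fun s => φ r u s) v

/-- `Q = (v / r) φ_r + u² φ_v`. -/
def Q (φ : ℝ → ℝ → ℝ → ℝ) (r u v : ℝ) : ℝ := v / r * dr φ r u v + u ^ 2 * dv φ r u v

end Finsler

end

/-!
Write `Q = y^k F_{x^k}`, which for `x ≠ 0` is the function `Q φ` of `(|x|, |y|, ⟨x, y⟩)`.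

A geodesic exists in every direction `y ≠ 0` at every point `x ∈ Ω`
(`IsFinslerMetric.exists_isGeodesicOn`). If it lies on a line, its acceleration is a multiple of its
velocity, so the spray of a projective metric is radial, `G^i = P y^i`. Contracting the equation
that defines the spray with `y` gives `P = Q / (2F)` and Hamel's equation `Q_{y^l} = 2 F_{x^l}`
(`IsProjective.spray_eq_and_hamel`).

For a radial spray, `R^i_k = Ξ δ^i_k + τ_k y^i` with `Ξ = P² - y^j P_{x^j}` (`riemann_eq`).
Flags whose edge is `g_y`-orthogonal to `y` see only `Ξ`, and the remaining flags determine `τ`; so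
the flag curvature is `lam` exactly if `Ξ = lam F²` and `τ_k = -lam F F_{y^k}`. Since
`Ξ_{y^k} = τ_k - 3 (P_{x^k} - P P_{y^k})`, both together say `P_{x^k} = P P_{y^k} - lam F F_{y^k}`
(`IsFinslerMetric.hasConstFlagCurvature_iff`). By Hamel's equation this is
`2 F² Q_{x^k} - 4 F Q F_{x^k} + (Q² + 4 lam F⁴) F_{y^k} = 0`
(`IsProjective.hasConstFlagCurvature_iff`).

By the chain rule, the left-hand side is a combination of `x^k` and `y^k` for `x ≠ 0`, and because
of `r Q_v = 2 φ_r`, the `x`-component of Hamel's equation, its coefficients are the two expressions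
in `φ`, up to positive factors (`IsProjective.curvatureExpr_eq`). Coefficients can be compared where
`x` and `y` are linearly independent; as `n ≥ 2`, such pairs are dense, and continuity gives the
equations at the other points of the domain of `φ` and at `x = 0`.
-/

noncomputable section

namespace Finsler

open Filter Topology Matrix

variable {n : ℕ}

/-! ### Calculus of the partial derivatives `pdx` and `pdy` -/

/-- `f(x, y)` is jointly `C^∞` near the point `(x, y)` of the tangent bundle. -/
def SmoothAt (f : E n → E n → ℝ) (x y : E n) : Prop :=
  ContDiffAt ℝ ∞ (fun p : E n × E n => f p.1 p.2) (x, y)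

section Calculus

variable {f g : E n → E n → ℝ} {x y : E n}

namespace SmoothAt

lemma differentiableAt (hf : SmoothAt f x y) :
    DifferentiableAt ℝ (fun p : E n × E n => f p.1 p.2) (x, y) :=
  ContDiffAt.differentiableAt hf (by simp)

lemma differentiableAt_fst (hf : SmoothAt f x y) : DifferentiableAt ℝ (fun z => f z y) x :=
  DifferentiableAt.comp (f := fun z : E n => (z, y)) x hf.differentiableAt (by fun_prop)

lemma differentiableAt_snd (hf : SmoothAt f x y) : DifferentiableAt ℝ (fun z => f x z) y :=
  DifferentiableAt.comp (f := fun z : E n => (x, z)) y hf.differentiableAt (by fun_prop)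

lemma continuousAt (hf : SmoothAt f x y) :
    ContinuousAt (fun p : E n × E n => f p.1 p.2) (x, y) :=
  ContDiffAt.continuousAt hf

lemma const (c : ℝ) : SmoothAt (fun _ _ => c) x y := contDiffAt_const

lemma coord (i : Fin n) : SmoothAt (fun _ y => y i) x y := by
  unfold SmoothAt
  have : ContDiff ℝ ∞ (fun p : E n × E n => EuclideanSpace.proj (𝕜 := ℝ) i p.2) := by fun_prop
  exact this.contDiffAt

lemma add (hf : SmoothAt f x y) (hg : SmoothAt g x y) :
    SmoothAt (fun x y => f x y + g x y) x y := ContDiffAt.add hf hg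

lemma sub (hf : SmoothAt f x y) (hg : SmoothAt g x y) :
    SmoothAt (fun x y => f x y - g x y) x y := ContDiffAt.sub hf hg

lemma mul (hf : SmoothAt f x y) (hg : SmoothAt g x y) :
    SmoothAt (fun x y => f x y * g x y) x y := ContDiffAt.mul hf hg

lemma div (hf : SmoothAt f x y) (hg : SmoothAt g x y) (h0 : g x y ≠ 0) :
    SmoothAt (fun x y => f x y / g x y) x y := ContDiffAt.div hf hg h0

lemma pow (hf : SmoothAt f x y) (m : ℕ) : SmoothAt (fun x y => f x y ^ m) x y :=
  ContDiffAt.pow hf m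

lemma sum {ι : Type*} {s : Finset ι} {f : ι → E n → E n → ℝ}
    (hf : ∀ i ∈ s, SmoothAt (f i) x y) : SmoothAt (fun x y => ∑ i ∈ s, f i x y) x y :=
  ContDiffAt.sum hf

lemma prod {ι : Type*} {s : Finset ι} {f : ι → E n → E n → ℝ}
    (hf : ∀ i ∈ s, SmoothAt (f i) x y) : SmoothAt (fun x y => ∏ i ∈ s, f i x y) x y :=
  contDiffAt_prod hf

end SmoothAt

lemma pdx_eq_fderiv (hf : DifferentiableAt ℝ (fun p : E n × E n => f p.1 p.2) (x, y))
    (i : Fin n) :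
    pdx i f x y = fderiv ℝ (fun p : E n × E n => f p.1 p.2) (x, y)
      (EuclideanSpace.single i 1, 0) := by
  have h := hf.hasFDerivAt.comp (f := fun z : E n => (z, y)) x
    ((hasFDerivAt_id x).prodMk (hasFDerivAt_const y x))
  have h' : HasFDerivAt (fun z => f z y) _ x := h
  rw [pdx, h'.fderiv]
  simp

lemma pdy_eq_fderiv (hf : DifferentiableAt ℝ (fun p : E n × E n => f p.1 p.2) (x, y))
    (i : Fin n) :
    pdy i f x y = fderiv ℝ (fun p : E n × E n => f p.1 p.2) (x, y)
      (0, EuclideanSpace.single i 1) := by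
  have h := hf.hasFDerivAt.comp (f := fun z : E n => (x, z)) y
    ((hasFDerivAt_const x y).prodMk (hasFDerivAt_id y))
  have h' : HasFDerivAt (fun z => f x z) _ y := h
  rw [pdy, h'.fderiv]
  simp

namespace SmoothAt

lemma eventually_differentiableAt (hf : SmoothAt f x y) :
    ∀ᶠ p in 𝓝 (x, y), DifferentiableAt ℝ (fun p : E n × E n => f p.1 p.2) p := by
  have h1 : ContDiffAt ℝ 1 (fun p : E n × E n => f p.1 p.2) (x, y) := ContDiffAt.of_le hf (by simp)
  exact (h1.eventually (by simp)).mono fun p hp => hp.differentiableAt (by simp)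

lemma pdx_eventuallyEq (hf : SmoothAt f x y) (i : Fin n) :
    (fun p : E n × E n => Finsler.pdx i f p.1 p.2) =ᶠ[𝓝 (x, y)] fun p =>
      fderiv ℝ (fun p : E n × E n => f p.1 p.2) p (EuclideanSpace.single i 1, 0) :=
  hf.eventually_differentiableAt.mono fun _ hp => pdx_eq_fderiv hp i

lemma pdy_eventuallyEq (hf : SmoothAt f x y) (i : Fin n) :
    (fun p : E n × E n => Finsler.pdy i f p.1 p.2) =ᶠ[𝓝 (x, y)] fun p =>
      fderiv ℝ (fun p : E n × E n => f p.1 p.2) p (0, EuclideanSpace.single i 1) :=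
  hf.eventually_differentiableAt.mono fun _ hp => pdy_eq_fderiv hp i

lemma fderiv (hf : SmoothAt f x y) :
    ContDiffAt ℝ ∞ (_root_.fderiv ℝ (fun p : E n × E n => f p.1 p.2)) (x, y) :=
  ContDiffAt.fderiv_right hf (by simp)

lemma pdx (hf : SmoothAt f x y) (i : Fin n) : SmoothAt (pdx i f) x y :=
  (hf.fderiv.clm_apply contDiffAt_const).congr_of_eventuallyEq (hf.pdx_eventuallyEq i)

lemma pdy (hf : SmoothAt f x y) (i : Fin n) : SmoothAt (pdy i f) x y :=
  (hf.fderiv.clm_apply contDiffAt_const).congr_of_eventuallyEq (hf.pdy_eventuallyEq i)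

end SmoothAt

lemma fderiv_fderiv_apply {G : Type*} [NormedAddCommGroup G] [NormedSpace ℝ G] {h : G → ℝ} {p : G}
    (hd : DifferentiableAt ℝ (fderiv ℝ h) p) (v w : G) :
    fderiv ℝ (fun q => fderiv ℝ h q v) p w = fderiv ℝ (fderiv ℝ h) p w v := by
  rw [fderiv_clm_apply hd (by fun_prop)]
  simp

lemma pdx_pdy_comm (hf : SmoothAt f x y) (i j : Fin n) :
    pdx i (pdy j f) x y = pdy j (pdx i f) x y := by
  rw [pdx_eq_fderiv (hf.pdy j).differentiableAt, pdy_eq_fderiv (hf.pdx i).differentiableAt,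
    (hf.pdx_eventuallyEq i).fderiv_eq, (hf.pdy_eventuallyEq j).fderiv_eq,
    fderiv_fderiv_apply (hf.fderiv.differentiableAt (by simp)),
    fderiv_fderiv_apply (hf.fderiv.differentiableAt (by simp))]
  exact ContDiffAt.isSymmSndFDerivAt (n := ∞) hf
    (by simpa using WithTop.coe_le_coe.mpr (le_top : (2 : ℕ∞) ≤ ⊤)) _ _

lemma pdy_pdy_comm (hf : SmoothAt f x y) (i j : Fin n) :
    pdy i (pdy j f) x y = pdy j (pdy i f) x y := by
  rw [pdy_eq_fderiv (hf.pdy j).differentiableAt, pdy_eq_fderiv (hf.pdy i).differentiableAt,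
    (hf.pdy_eventuallyEq i).fderiv_eq, (hf.pdy_eventuallyEq j).fderiv_eq,
    fderiv_fderiv_apply (hf.fderiv.differentiableAt (by simp)),
    fderiv_fderiv_apply (hf.fderiv.differentiableAt (by simp))]
  exact ContDiffAt.isSymmSndFDerivAt (n := ∞) hf
    (by simpa using WithTop.coe_le_coe.mpr (le_top : (2 : ℕ∞) ≤ ⊤)) _ _

lemma pdx_congr (h : ∀ᶠ z in 𝓝 x, f z y = g z y) (i : Fin n) : pdx i f x y = pdx i g x y := by
  have h' : (fun z => f z y) =ᶠ[𝓝 x] fun z => g z y := h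
  rw [pdx, pdx, h'.fderiv_eq]

lemma pdy_congr (h : ∀ᶠ z in 𝓝 y, f x z = g x z) (i : Fin n) : pdy i f x y = pdy i g x y := by
  have h' : (fun z => f x z) =ᶠ[𝓝 y] fun z => g x z := h
  rw [pdy, pdy, h'.fderiv_eq]

lemma pdx_coord (i k : Fin n) : pdx k (fun _ y => y i) x y = 0 := by
  simp [pdx]

lemma pdy_coord (i k : Fin n) : pdy k (fun _ y => y i) x y = if i = k then 1 else 0 := by
  have h : HasFDerivAt (fun z : E n => z i) (EuclideanSpace.proj (𝕜 := ℝ) i) y :=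
    (EuclideanSpace.proj (𝕜 := ℝ) i).hasFDerivAt
  rw [pdy, h.fderiv]
  simp

lemma pdx_add (hf : SmoothAt f x y) (hg : SmoothAt g x y) (k : Fin n) :
    pdx k (fun x y => f x y + g x y) x y = pdx k f x y + pdx k g x y := by
  simp only [pdx]
  rw [fderiv_fun_add hf.differentiableAt_fst hg.differentiableAt_fst]
  simp

lemma pdy_add (hf : SmoothAt f x y) (hg : SmoothAt g x y) (k : Fin n) :
    pdy k (fun x y => f x y + g x y) x y = pdy k f x y + pdy k g x y := by
  simp only [pdy]
  rw [fderiv_fun_add hf.differentiableAt_snd hg.differentiableAt_snd]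
  simp

lemma pdy_sub (hf : SmoothAt f x y) (hg : SmoothAt g x y) (k : Fin n) :
    pdy k (fun x y => f x y - g x y) x y = pdy k f x y - pdy k g x y := by
  simp only [pdy]
  rw [fderiv_fun_sub hf.differentiableAt_snd hg.differentiableAt_snd]
  simp

lemma pdx_mul (hf : SmoothAt f x y) (hg : SmoothAt g x y) (k : Fin n) :
    pdx k (fun x y => f x y * g x y) x y = f x y * pdx k g x y + g x y * pdx k f x y := by
  simp only [pdx]
  rw [fderiv_fun_mul hf.differentiableAt_fst hg.differentiableAt_fst]
  simp

lemma pdy_mul (hf : SmoothAt f x y) (hg : SmoothAt g x y) (k : Fin n) :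
    pdy k (fun x y => f x y * g x y) x y = f x y * pdy k g x y + g x y * pdy k f x y := by
  simp only [pdy]
  rw [fderiv_fun_mul hf.differentiableAt_snd hg.differentiableAt_snd]
  simp

lemma pdx_const_mul (hf : SmoothAt f x y) (c : ℝ) (k : Fin n) :
    pdx k (fun x y => c * f x y) x y = c * pdx k f x y := by
  rw [pdx_mul (.const c) hf]
  simp [pdx]

lemma pdy_const_mul (hf : SmoothAt f x y) (c : ℝ) (k : Fin n) :
    pdy k (fun x y => c * f x y) x y = c * pdy k f x y := by
  rw [pdy_mul (.const c) hf]
  simp [pdy]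

lemma pdx_sq (hf : SmoothAt f x y) (k : Fin n) :
    pdx k (fun x y => f x y ^ 2) x y = 2 * f x y * pdx k f x y := by
  simp only [pow_two]
  rw [pdx_mul hf hf]
  ring

lemma pdy_sq (hf : SmoothAt f x y) (k : Fin n) :
    pdy k (fun x y => f x y ^ 2) x y = 2 * f x y * pdy k f x y := by
  simp only [pow_two]
  rw [pdy_mul hf hf]
  ring

lemma pdy_sum {ι : Type*} {s : Finset ι} {f : ι → E n → E n → ℝ}
    (hf : ∀ i ∈ s, SmoothAt (f i) x y) (k : Fin n) :
    pdy k (fun x y => ∑ i ∈ s, f i x y) x y = ∑ i ∈ s, pdy k (f i) x y := by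
  simp only [pdy]
  rw [fderiv_fun_sum fun i hi => (hf i hi).differentiableAt_snd]
  simp

lemma pdy_sum_coord_mul {f : Fin n → E n → E n → ℝ} (hf : ∀ i, SmoothAt (f i) x y) (k : Fin n) :
    pdy k (fun x y => ∑ i, y i * f i x y) x y = f k x y + ∑ i, y i * pdy k (f i) x y := by
  rw [pdy_sum fun i _ => (SmoothAt.coord i).mul (hf i)]
  have h : ∀ i, pdy k (fun x y => y i * f i x y) x y
      = y i * pdy k (f i) x y + f i x y * if i = k then 1 else 0 := fun i => by
    rw [pdy_mul (.coord i) (hf i), pdy_coord]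
  simp [h, Finset.sum_add_distrib, add_comm]

/-- **Euler's theorem** for a function that is positively homogeneous of degree `m` in `y`. -/
lemma sum_coord_mul_pdy_of_homog (hf : SmoothAt f x y) (m : ℕ)
    (h : ∀ c : ℝ, 0 < c → f x (c • y) = c ^ m * f x y) :
    ∑ k, y k * pdy k f x y = m * f x y := by
  have hy : y = ∑ k, y k • EuclideanSpace.single k (1 : ℝ) := by
    ext i
    simp [Pi.single_apply]
  have h1 : ∑ k, y k * pdy k f x y = fderiv ℝ (fun z => f x z) y y := by
    conv_rhs => arg 2; rw [hy]
    simp [pdy]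
  have h2 : HasDerivAt (fun c : ℝ => f x (c • y)) (fderiv ℝ (fun z => f x z) y y) 1 := by
    have h3 : HasDerivAt (fun c : ℝ => c • y) y 1 := by
      simpa using (hasDerivAt_id (1 : ℝ)).smul_const y
    have h4 : HasFDerivAt (fun z => f x z) (fderiv ℝ (fun z => f x z) y) ((1 : ℝ) • y) := by
      simpa using hf.differentiableAt_snd.hasFDerivAt
    exact h4.comp_hasDerivAt (1 : ℝ) h3
  have h5 : HasDerivAt (fun c : ℝ => c ^ m * f x y) (m * f x y) 1 := by
    simpa using (hasDerivAt_pow m (1 : ℝ)).mul_const (f x y)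
  have h6 : (fun c : ℝ => f x (c • y)) =ᶠ[𝓝 1] fun c : ℝ => c ^ m * f x y := by
    filter_upwards [lt_mem_nhds one_pos] with c hc using h c hc
  rw [h1]
  exact (h2.congr_of_eventuallyEq h6.symm).unique h5

end Calculus

/-! ### The fundamental tensor and the spray -/

lemma eventually_ne_zero {y : E n} (hy : y ≠ 0) : ∀ᶠ z in 𝓝 y, z ≠ 0 :=
  isOpen_ne.mem_nhds hy

section Metric

variable {Ω : Set (E n)} {F : E n → E n → ℝ} {x y : E n}

lemma IsFinslerMetric.smoothAt (hF : IsFinslerMetric Ω F) (hΩ : IsOpen Ω) (hx : x ∈ Ω)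
    (hy : y ≠ 0) : SmoothAt F x y :=
  hF.smooth.contDiffAt ((hΩ.prod isOpen_compl_singleton).mem_nhds ⟨hx, hy⟩)

lemma IsFinslerMetric.sum_coord_mul_pdy (hF : IsFinslerMetric Ω F) (hΩ : IsOpen Ω) (hx : x ∈ Ω)
    (hy : y ≠ 0) : ∑ k, y k * pdy k F x y = F x y := by
  simpa using sum_coord_mul_pdy_of_homog (hF.smoothAt hΩ hx hy) 1
    fun c hc => by simpa using hF.homog x hx y c hc

lemma IsFinslerMetric.fundTensor_symm (hF : IsFinslerMetric Ω F) (hx : x ∈ Ω) (hy : y ≠ 0)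
    (i j : Fin n) : fundTensor F x y i j = fundTensor F x y j i := by
  simpa using (hF.posDef x hx y hy).isHermitian.apply j i

lemma IsFinslerMetric.sum_fundTensor_mul_coord (hF : IsFinslerMetric Ω F) (hΩ : IsOpen Ω)
    (hx : x ∈ Ω) (hy : y ≠ 0) (j : Fin n) :
    ∑ i, fundTensor F x y j i * y i = F x y * pdy j F x y := by
  have hs := hF.smoothAt hΩ hx hy
  have hL : SmoothAt (sqF F) x y := hs.pow 2
  -- differentiate Euler's identity for `F²` in the direction `y^j`
  have h1 : pdy j (fun x y => ∑ i, y i * pdy i (sqF F) x y) x y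
      = pdy j (fun x y => 2 * sqF F x y) x y := by
    refine pdy_congr ?_ j
    filter_upwards [eventually_ne_zero hy] with z hz
    have := sum_coord_mul_pdy_of_homog (f := sqF F) ((hF.smoothAt hΩ hx hz).pow 2) 2
      fun c hc => by simp [sqF, hF.homog x hx z c hc, mul_pow]
    simpa using this
  rw [pdy_sum_coord_mul (fun i => hL.pdy i), pdy_const_mul hL] at h1
  have h2 : pdy j (sqF F) x y = 2 * F x y * pdy j F x y := pdy_sq hs j
  have h3 : ∑ i, fundTensor F x y j i * y i
      = (1 / 2) * ∑ i, y i * pdy j (pdy i (sqF F)) x y := by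
    rw [Finset.mul_sum]
    refine Finset.sum_congr rfl fun i _ => ?_
    simp only [fundTensor, Matrix.of_apply]
    ring
  rw [h3]
  linarith

lemma IsFinslerMetric.gInner_self_left (hF : IsFinslerMetric Ω F) (hΩ : IsOpen Ω)
    (hx : x ∈ Ω) (hy : y ≠ 0) (w : E n) :
    gInner F x y y w = F x y * ∑ j, pdy j F x y * w j := by
  rw [gInner, Finset.sum_comm, Finset.mul_sum]
  refine Finset.sum_congr rfl fun j _ => ?_
  rw [← Finset.sum_mul, ← mul_assoc, ← hF.sum_fundTensor_mul_coord hΩ hx hy j]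
  simp only [hF.fundTensor_symm hx hy _ j]

lemma IsFinslerMetric.gInner_self_self (hF : IsFinslerMetric Ω F) (hΩ : IsOpen Ω)
    (hx : x ∈ Ω) (hy : y ≠ 0) : gInner F x y y y = F x y ^ 2 := by
  rw [hF.gInner_self_left hΩ hx hy, ← hF.sum_coord_mul_pdy hΩ hx hy, pow_two]
  simp only [mul_comm]

lemma IsFinslerMetric.gInner_symm (hF : IsFinslerMetric Ω F)
    (hx : x ∈ Ω) (hy : y ≠ 0) (v w : E n) : gInner F x y v w = gInner F x y w v := by
  rw [gInner, gInner, Finset.sum_comm]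
  refine Finset.sum_congr rfl fun j _ => Finset.sum_congr rfl fun i _ => ?_
  rw [hF.fundTensor_symm hx hy i j]
  ring

lemma gInner_add_smul_left (F : E n → E n → ℝ) (x y u v w : E n) (a b : ℝ) :
    gInner F x y (a • u + b • v) w = a * gInner F x y u w + b * gInner F x y v w := by
  simp only [gInner, Finset.mul_sum, ← Finset.sum_add_distrib]
  refine Finset.sum_congr rfl fun j _ => Finset.sum_congr rfl fun i _ => ?_
  simp
  ring

lemma IsFinslerMetric.gInner_pos (hF : IsFinslerMetric Ω F) (hx : x ∈ Ω) (hy : y ≠ 0) {w : E n}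
    (hw : w ≠ 0) : 0 < gInner F x y w w := by
  have h := (hF.posDef x hx y hy).dotProduct_mulVec_pos (x := w.ofLp) (by simpa using hw)
  have h' : gInner F x y w w = star w.ofLp ⬝ᵥ (fundTensor F x y).mulVec w.ofLp := by
    simp only [gInner, dotProduct, Matrix.mulVec, Finset.mul_sum]
    refine Finset.sum_congr rfl fun j _ => Finset.sum_congr rfl fun i _ => ?_
    simp only [Pi.star_apply, star_trivial]
    ring
  rwa [h']

lemma smoothAt_det {ι : Type*} [Fintype ι] [DecidableEq ι] {M : E n → E n → Matrix ι ι ℝ}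
    (hM : ∀ i j, SmoothAt (fun x y => M x y i j) x y) : SmoothAt (fun x y => (M x y).det) x y := by
  simp only [Matrix.det_apply']
  exact .sum fun σ _ => (SmoothAt.const _).mul (.prod fun i _ => hM _ _)

lemma smoothAt_inv {ι : Type*} [Fintype ι] [DecidableEq ι] {M : E n → E n → Matrix ι ι ℝ}
    (hM : ∀ i j, SmoothAt (fun x y => M x y i j) x y) (h0 : (M x y).det ≠ 0) (i j : ι) :
    SmoothAt (fun x y => (M x y)⁻¹ i j) x y := by
  have h : (fun x y => (M x y)⁻¹ i j) =
      fun x y => ((M x y).updateRow j (Pi.single i 1)).det / (M x y).det := by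
    funext x y
    rw [Matrix.inv_def, Matrix.smul_apply, Matrix.adjugate_apply, Ring.inverse_eq_inv', smul_eq_mul,
      div_eq_inv_mul]
  rw [h]
  refine (smoothAt_det fun k l => ?_).div (smoothAt_det hM) h0
  by_cases hk : k = j
  · simp only [Matrix.updateRow_apply, hk, if_true]
    exact .const _
  · simpa only [Matrix.updateRow_apply, hk, if_false] using hM k l

lemma IsFinslerMetric.smoothAt_spray (hF : IsFinslerMetric Ω F) (hΩ : IsOpen Ω)
    (hx : x ∈ Ω) (hy : y ≠ 0) (i : Fin n) : SmoothAt (spray F i) x y := by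
  have hL : SmoothAt (sqF F) x y := (hF.smoothAt hΩ hx hy).pow 2
  have hg : ∀ i j, SmoothAt (fun x y => fundTensor F x y i j) x y := fun i j =>
    (SmoothAt.const _).mul ((hL.pdy j).pdy i)
  refine (SmoothAt.const _).mul (.sum fun l _ =>
    (smoothAt_inv hg (hF.posDef x hx y hy).det_pos.ne' i l).mul
    (.sub (.sum fun k _ => ((hL.pdy l).pdx k).mul (.coord k)) (hL.pdx l)))

/-- The defining linear system `g_{ji} G^i = ¼ ([F²]_{x^k y^j} y^k - [F²]_{x^j})` of the spray. -/
lemma IsFinslerMetric.sum_fundTensor_mul_spray (hF : IsFinslerMetric Ω F)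
    (hx : x ∈ Ω) (hy : y ≠ 0) (j : Fin n) :
    ∑ i, fundTensor F x y j i * spray F i x y
      = (1 / 4) * ((∑ k, pdx k (pdy j (sqF F)) x y * y k) - pdx j (sqF F) x y) := by
  set V : Fin n → ℝ := fun l => (∑ k, pdx k (pdy l (sqF F)) x y * y k) - pdx l (sqF F) x y with hV
  have hdet : IsUnit (fundTensor F x y).det := (hF.posDef x hx y hy).det_pos.ne'.isUnit
  have h1 : (fun i => spray F i x y) = (1 / 4 : ℝ) • ((fundTensor F x y)⁻¹.mulVec V) := by
    funext i
    simp [spray, Matrix.mulVec, dotProduct, hV]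
  have h2 : (fundTensor F x y).mulVec (fun i => spray F i x y) = (1 / 4 : ℝ) • V := by
    rw [h1, Matrix.mulVec_smul, Matrix.mulVec_mulVec, Matrix.mul_nonsing_inv _ hdet,
      Matrix.one_mulVec]
  exact congrFun h2 j

end Metric

/-! ### Existence of geodesics and the spray of a projective metric -/

section Projective

variable {Ω : Set (E n)} {F : E n → E n → ℝ} {x y : E n}

lemma IsFinslerMetric.contDiffAt_geodesicField (hF : IsFinslerMetric Ω F) (hΩ : IsOpen Ω)
    (hx : x ∈ Ω) (hy : y ≠ 0) :
    ContDiffAt ℝ ∞ (fun p : E n × E n =>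
      (p.2, (-2 : ℝ) • (WithLp.toLp 2 fun i => spray F i p.1 p.2 : E n))) (x, y) := by
  have h : ContDiffAt ℝ ∞ (fun p : E n × E n =>
      (WithLp.toLp 2 fun i => spray F i p.1 p.2 : E n)) (x, y) := by
    rw [contDiffAt_piLp]
    exact fun i => hF.smoothAt_spray hΩ hx hy i
  exact contDiffAt_snd.prodMk (h.const_smul _)

/-- By the Picard-Lindelöf theorem there is a geodesic with any given initial position and nonzero
initial velocity. -/
lemma IsFinslerMetric.exists_isGeodesicOn (hF : IsFinslerMetric Ω F) (hΩ : IsOpen Ω)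
    (hx : x ∈ Ω) (hy : y ≠ 0) :
    ∃ (c : ℝ → E n) (δ : ℝ), 0 < δ ∧ IsGeodesicOn Ω F c (-δ) δ ∧ c 0 = x ∧ deriv c 0 = y ∧
      ∀ t ∈ Set.Ioo (-δ) δ, HasDerivAt c (deriv c t) t ∧
        HasDerivAt (deriv c) (deriv (deriv c) t) t := by
  set V : E n × E n → E n × E n := fun p =>
    (p.2, (-2 : ℝ) • (WithLp.toLp 2 fun i => spray F i p.1 p.2 : E n)) with hV
  have hVs : ∀ p ∈ Ω ×ˢ ({0}ᶜ : Set (E n)), ContDiffAt ℝ ∞ V p := fun p hp =>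
    hF.contDiffAt_geodesicField hΩ hp.1 hp.2
  have hU : IsOpen (Ω ×ˢ ({0}ᶜ : Set (E n))) := hΩ.prod isOpen_compl_singleton
  obtain ⟨α, hα0, ε, hε, hα⟩ :=
    ((hVs (x, y) ⟨hx, hy⟩).of_le
      (by simp)).exists_forall_mem_closedBall_exists_eq_forall_mem_Ioo_hasDerivAt₀ 0
  have hcont : ContinuousAt α 0 := (hα 0 (by simp [hε])).continuousAt
  obtain ⟨δ', hδ', hball⟩ := Metric.eventually_nhds_iff.mp
    (hcont.eventually (hU.mem_nhds (by rw [hα0]; exact ⟨hx, hy⟩)))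
  set δ := min ε δ' with hδ
  have hδ0 : 0 < δ := lt_min hε hδ'
  have hI : ∀ t ∈ Set.Ioo (-δ) δ, HasDerivAt α (V (α t)) t ∧ α t ∈ Ω ×ˢ ({0}ᶜ : Set (E n)) := by
    intro t ht
    have h1 : |t| < δ := abs_lt.mpr ht
    have h2 : |t| < ε := h1.trans_le (min_le_left _ _)
    have h3 : |t| < δ' := h1.trans_le (min_le_right _ _)
    refine ⟨hα t ?_, hball (by simpa using h3)⟩
    simpa using abs_lt.mp h2
  have hc : ∀ t ∈ Set.Ioo (-δ) δ, HasDerivAt (fun t => (α t).1) (α t).2 t := fun t ht =>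
    (hI t ht).1.fst
  have hdc : ∀ t ∈ Set.Ioo (-δ) δ, deriv (fun t => (α t).1) t = (α t).2 := fun t ht =>
    (hc t ht).deriv
  have hdc' : ∀ t ∈ Set.Ioo (-δ) δ,
      deriv (fun t => (α t).1) =ᶠ[𝓝 t] fun t => (α t).2 := fun t ht => by
    filter_upwards [isOpen_Ioo.mem_nhds ht] with s hs using hdc s hs
  have hddc : ∀ t ∈ Set.Ioo (-δ) δ,
      HasDerivAt (deriv fun t => (α t).1) (V (α t)).2 t := fun t ht => by
    have h : HasDerivAt (fun t => (α t).2) (V (α t)).2 t := (hI t ht).1.snd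
    exact h.congr_of_eventuallyEq (hdc' t ht)
  have h0 : (0 : ℝ) ∈ Set.Ioo (-δ) δ := by simp [hδ0]
  refine ⟨fun t => (α t).1, δ, hδ0, ⟨?_, ?_⟩, by simp [hα0], by rw [hdc 0 h0, hα0], ?_⟩
  · -- the velocity is `C¹` since its derivative is a continuous function of `α`
    have hα1 : ContDiffOn ℝ 1 α (Set.Ioo (-δ) δ) := by
      rw [show (1 : WithTop ℕ∞) = 0 + 1 from rfl, contDiffOn_succ_iff_deriv_of_isOpen isOpen_Ioo]
      refine ⟨fun t ht => (hI t ht).1.differentiableAt.differentiableWithinAt, by simp, ?_⟩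
      rw [contDiffOn_zero]
      intro t ht
      refine ContinuousAt.continuousWithinAt ?_
      have h1 : ContinuousAt (fun t => V (α t)) t :=
        ContinuousAt.comp (hVs _ (hI t ht).2).continuousAt (hI t ht).1.continuousAt
      refine h1.congr ?_
      filter_upwards [isOpen_Ioo.mem_nhds ht] with s hs using ((hI s hs).1.deriv).symm
    rw [show (2 : WithTop ℕ∞) = 1 + 1 from by norm_num,
      contDiffOn_succ_iff_deriv_of_isOpen isOpen_Ioo]
    refine ⟨fun t ht => (hc t ht).differentiableAt.differentiableWithinAt, by simp, ?_⟩
    exact hα1.snd.congr hdc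
  · intro t ht
    refine ⟨(hI t ht).2.1, ?_, fun i => ?_⟩
    · rw [hdc t ht]
      exact (hI t ht).2.2
    · rw [hdc t ht, (hddc t ht).deriv]
      simp [hV]
  · intro t ht
    rw [hdc t ht, (hddc t ht).deriv]
    exact ⟨hc t ht, hddc t ht⟩

/-- Along a curve contained in a line the acceleration is a multiple of the (nonzero) velocity, so
the spray of a projective metric is radial. -/
lemma IsProjective.exists_spray_eq (hproj : IsProjective Ω F) (hF : IsFinslerMetric Ω F)
    (hΩ : IsOpen Ω) (hx : x ∈ Ω) (hy : y ≠ 0) : ∃ a : ℝ, ∀ i, spray F i x y = a * y i := by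
  obtain ⟨c, δ, hδ, hgeo, hc0, hc1, hder⟩ := hF.exists_isGeodesicOn hΩ hx hy
  obtain ⟨p, w, hline⟩ := hproj c _ _ hgeo
  have h0 : (0 : ℝ) ∈ Set.Ioo (-δ) δ := by simp [hδ]
  have horth : ∀ z : E n, inner ℝ z w = 0 → ∀ t ∈ Set.Ioo (-δ) δ, inner ℝ z (deriv c t) = 0 := by
    intro z hz t ht
    have h1 : HasDerivAt (fun s => inner ℝ z (c s)) (inner ℝ z (deriv c t)) t := by
      simpa using (hasDerivAt_const t z).inner ℝ (hder t ht).1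
    have h2 : (fun s => inner ℝ z (c s)) =ᶠ[𝓝 t] fun _ => inner ℝ z p := by
      filter_upwards [isOpen_Ioo.mem_nhds ht] with s hs
      obtain ⟨a, ha⟩ := hline s hs
      simp [ha, inner_add_right, inner_smul_right, hz]
    exact h1.unique ((hasDerivAt_const t (inner ℝ z p)).congr_of_eventuallyEq h2)
  have horth2 : ∀ z : E n, inner ℝ z w = 0 → inner ℝ z (deriv (deriv c) 0) = 0 := by
    intro z hz
    have h1 : HasDerivAt (fun s => inner ℝ z (deriv c s)) (inner ℝ z (deriv (deriv c) 0)) 0 := by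
      simpa using (hasDerivAt_const (0 : ℝ) z).inner ℝ (hder 0 h0).2
    have h2 : (fun s => inner ℝ z (deriv c s)) =ᶠ[𝓝 0] fun _ => 0 := by
      filter_upwards [isOpen_Ioo.mem_nhds h0] with s hs using horth z hz s hs
    exact h1.unique ((hasDerivAt_const (0 : ℝ) (0 : ℝ)).congr_of_eventuallyEq h2)
  have hspan : ∀ u : E n, (∀ z : E n, inner ℝ z w = 0 → inner ℝ z u = 0) →
      u ∈ Submodule.span ℝ {w} := by
    intro u hu
    rw [← Submodule.orthogonal_orthogonal (Submodule.span ℝ {w}), Submodule.mem_orthogonal]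
    intro z hz
    refine hu z ?_
    rw [real_inner_comm]
    exact Submodule.mem_orthogonal_singleton_iff_inner_right.mp hz
  obtain ⟨a, ha⟩ := Submodule.mem_span_singleton.mp (hspan _ fun z hz => hc1 ▸ horth z hz 0 h0)
  obtain ⟨b, hb⟩ := Submodule.mem_span_singleton.mp (hspan _ horth2)
  have ha0 : a ≠ 0 := by
    rintro rfl
    exact hy (by simpa using ha.symm)
  refine ⟨-(b / (2 * a)), fun i => ?_⟩
  have h := (hgeo.2 0 h0).2.2 i
  rw [hc0, hc1, ← hb] at h
  rw [← ha] at h ⊢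
  simp only [PiLp.smul_apply, smul_eq_mul] at h ⊢
  field_simp
  linarith

/-- The derivative `y^k ∂F/∂x^k` of `F` along the line through `x` in the direction `y`. -/
def lineDeriv (F : E n → E n → ℝ) (x y : E n) : ℝ := ∑ k, y k * pdx k F x y

/-- The projective factor `P = y^k F_{x^k} / (2 F)`; the spray of a projective metric is
`G^i = P y^i`. -/
def projFactor (F : E n → E n → ℝ) (x y : E n) : ℝ := lineDeriv F x y / (2 * F x y)

lemma SmoothAt.lineDeriv (hs : SmoothAt F x y) : SmoothAt (lineDeriv F) x y :=
  .sum fun k _ => (SmoothAt.coord k).mul (hs.pdx k)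

lemma IsFinslerMetric.smoothAt_projFactor (hF : IsFinslerMetric Ω F) (hΩ : IsOpen Ω)
    (hx : x ∈ Ω) (hy : y ≠ 0) : SmoothAt (projFactor F) x y :=
  (hF.smoothAt hΩ hx hy).lineDeriv.div ((SmoothAt.const 2).mul (hF.smoothAt hΩ hx hy))
    (mul_pos two_pos (hF.pos x hx y hy)).ne'

lemma IsFinslerMetric.lineDeriv_eq (hF : IsFinslerMetric Ω F) (hx : x ∈ Ω) (hy : y ≠ 0) :
    2 * F x y * projFactor F x y = lineDeriv F x y := by
  have := (hF.pos x hx y hy).ne'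
  rw [projFactor]
  field_simp

lemma IsFinslerMetric.sum_coord_mul_pdy_lineDeriv (hF : IsFinslerMetric Ω F) (hΩ : IsOpen Ω)
    (hx : x ∈ Ω) (hy : y ≠ 0) :
    ∑ k, y k * pdy k (lineDeriv F) x y = 2 * lineDeriv F x y := by
  have hs := hF.smoothAt hΩ hx hy
  refine mod_cast sum_coord_mul_pdy_of_homog hs.lineDeriv 2 fun c hc => ?_
  have h : ∀ k, pdx k F x (c • y) = c * pdx k F x y := fun k => by
    rw [← pdx_const_mul hs]
    have h' : (fun z => F z (c • y)) =ᶠ[𝓝 x] fun z => c * F z y := by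
      filter_upwards [hΩ.mem_nhds hx] with z hz using hF.homog z hz y c hc
    rw [pdx, pdx, h'.fderiv_eq]
  simp only [lineDeriv, h, Finset.mul_sum]
  refine Finset.sum_congr rfl fun k _ => ?_
  simp only [PiLp.smul_apply, smul_eq_mul]
  ring

/-- The spray equation of a projective metric, contracted with the fundamental tensor, determines
the radial factor of the spray and yields Hamel's equation
`∂(y^k F_{x^k})/∂y^l = 2 ∂F/∂x^l`. -/
lemma IsProjective.spray_eq_and_hamel (hproj : IsProjective Ω F) (hF : IsFinslerMetric Ω F)
    (hΩ : IsOpen Ω) (hx : x ∈ Ω) (hy : y ≠ 0) :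
    (∀ i, spray F i x y = projFactor F x y * y i) ∧
      ∀ l, pdy l (lineDeriv F) x y = 2 * pdx l F x y := by
  obtain ⟨a, ha⟩ := hproj.exists_spray_eq hF hΩ hx hy
  have hs := hF.smoothAt hΩ hx hy
  have hL : SmoothAt (sqF F) x y := hs.pow 2
  have hF0 := hF.pos x hx y hy
  have hVl : ∀ l, (∑ k, pdx k (pdy l (sqF F)) x y * y k) - pdx l (sqF F) x y
      = 2 * F x y * pdy l (lineDeriv F) x y + 2 * lineDeriv F x y * pdy l F x y
        - 4 * F x y * pdx l F x y := by
    intro l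
    have h1 : ∑ k, pdx k (pdy l (sqF F)) x y * y k
        = ∑ k, y k * pdy l (pdx k (sqF F)) x y :=
      Finset.sum_congr rfl fun k _ => by rw [pdx_pdy_comm hL, mul_comm]
    have h2 := pdy_sum_coord_mul (fun i => hL.pdx i) l
    have h3 : pdy l (fun x y => ∑ i, y i * pdx i (sqF F) x y) x y
        = pdy l (fun x y => (2 * F x y) * lineDeriv F x y) x y := by
      refine pdy_congr ?_ l
      filter_upwards [eventually_ne_zero hy] with z hz
      rw [lineDeriv, Finset.mul_sum]
      refine Finset.sum_congr rfl fun k _ => ?_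
      have : pdx k (sqF F) x z = 2 * F x z * pdx k F x z := pdx_sq (hF.smoothAt hΩ hx hz) k
      rw [this]
      ring
    have h4 : pdx l (sqF F) x y = 2 * F x y * pdx l F x y := pdx_sq hs l
    rw [pdy_mul ((SmoothAt.const 2).mul hs) hs.lineDeriv, pdy_const_mul hs] at h3
    rw [h1]
    linarith
  have hkey : ∀ l, 2 * F x y * pdy l (lineDeriv F) x y + 2 * lineDeriv F x y * pdy l F x y
        - 4 * F x y * pdx l F x y = 4 * a * F x y * pdy l F x y := by
    intro l
    have h := hF.sum_fundTensor_mul_spray hx hy l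
    have h' : ∑ i, fundTensor F x y l i * spray F i x y
        = a * (F x y * pdy l F x y) := by
      rw [← hF.sum_fundTensor_mul_coord hΩ hx hy l, Finset.mul_sum]
      exact Finset.sum_congr rfl fun i _ => by rw [ha]; ring
    rw [h', hVl] at h
    linarith
  have ha' : a = projFactor F x y := by
    -- contract with `y^l`
    have h := Finset.sum_congr (rfl : (Finset.univ : Finset (Fin n)) = Finset.univ)
      fun l _ => congrArg (fun s => y l * s) (hkey l)
    have h1 : ∑ l, y l * (2 * F x y * pdy l (lineDeriv F) x y
        + 2 * lineDeriv F x y * pdy l F x y - 4 * F x y * pdx l F x y)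
        = 2 * F x y * ∑ l, y l * pdy l (lineDeriv F) x y
          + 2 * lineDeriv F x y * ∑ l, y l * pdy l F x y - 4 * F x y * lineDeriv F x y := by
      rw [lineDeriv]
      simp only [Finset.mul_sum, ← Finset.sum_add_distrib, ← Finset.sum_sub_distrib]
      exact Finset.sum_congr rfl fun l _ => by ring
    have h2 : ∑ l, y l * (4 * a * F x y * pdy l F x y)
        = 4 * a * F x y * ∑ l, y l * pdy l F x y := by
      rw [Finset.mul_sum]
      exact Finset.sum_congr rfl fun l _ => by ring
    rw [h1, h2, hF.sum_coord_mul_pdy hΩ hx hy, hF.sum_coord_mul_pdy_lineDeriv hΩ hx hy,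
      ← hF.lineDeriv_eq hx hy] at h
    have h3 : F x y ^ 2 * a = F x y ^ 2 * projFactor F x y := by linarith
    exact mul_left_cancel₀ (by positivity) h3
  refine ⟨ha' ▸ ha, fun l => ?_⟩
  have h := hkey l
  rw [ha', ← hF.lineDeriv_eq hx hy] at h
  have h3 : F x y * pdy l (lineDeriv F) x y = F x y * (2 * pdx l F x y) := by linarith
  exact mul_left_cancel₀ hF0.ne' h3

end Projective

/-! ### The Riemann curvature of a spray `G^i = P y^i` -/

section Curvature

variable {Ω : Set (E n)} {F P : E n → E n → ℝ} {x y : E n}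

/-- The coefficient `Ξ = P² - y^j P_{x^j}` of the identity in the Riemann curvature
`R^i_k = Ξ δ^i_k + τ_k y^i` of a spray `G^i = P y^i`. -/
def riemannScalar (P : E n → E n → ℝ) (x y : E n) : ℝ := P x y ^ 2 - ∑ j, y j * pdx j P x y

/-- The covector `τ_k = 2 P_{x^k} - y^j P_{x^j y^k} - P P_{y^k}` in the Riemann curvature
`R^i_k = Ξ δ^i_k + τ_k y^i` of a spray `G^i = P y^i`. -/
def riemannCovector (P : E n → E n → ℝ) (k : Fin n) (x y : E n) : ℝ :=
  2 * pdx k P x y - ∑ j, y j * pdx j (pdy k P) x y - P x y * pdy k P x y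

lemma riemann_eq (hΩ : IsOpen Ω) (hP : ∀ x ∈ Ω, ∀ y, y ≠ 0 → SmoothAt P x y)
    (hG : ∀ x ∈ Ω, ∀ y, y ≠ 0 → ∀ i, spray F i x y = P x y * y i)
    (hE : ∀ x ∈ Ω, ∀ y, y ≠ 0 → ∑ j, y j * pdy j P x y = P x y)
    (hx : x ∈ Ω) (hy : y ≠ 0) (i k : Fin n) :
    riemann F i k x y
      = riemannScalar P x y * (if i = k then 1 else 0) + riemannCovector P k x y * y i := by
  have hs := hP x hx y hy
  have hGx : ∀ {z : E n}, z ≠ 0 → ∀ i, ∀ᶠ x' in 𝓝 x, spray F i x' z = P x' z * z i :=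
    fun hz i => by filter_upwards [hΩ.mem_nhds hx] with x' hx' using hG x' hx' _ hz i
  have hdy : ∀ x ∈ Ω, ∀ y, y ≠ 0 → ∀ i k, pdy k (spray F i) x y
      = y i * pdy k P x y + (if i = k then 1 else 0) * P x y := by
    intro x hx y hy i k
    have h : pdy k (spray F i) x y = pdy k (fun x y => P x y * y i) x y := by
      refine pdy_congr ?_ k
      filter_upwards [eventually_ne_zero hy] with z hz using hG x hx z hz i
    rw [h, pdy_mul (hP x hx y hy) (.coord i), pdy_coord]
    ring
  have hdx : pdx k (spray F i) x y = y i * pdx k P x y := by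
    rw [pdx_congr (g := fun x y => P x y * y i) (hGx hy i), pdx_mul hs (.coord i), pdx_coord]
    ring
  have hdxy : ∀ j, pdx j (pdy k (spray F i)) x y
      = y i * pdx j (pdy k P) x y + (if i = k then 1 else 0) * pdx j P x y := by
    intro j
    rw [pdx_congr (g := fun x y => y i * pdy k P x y + (if i = k then 1 else 0) * P x y),
      pdx_add ((SmoothAt.coord i).mul (hs.pdy k)) ((SmoothAt.const _).mul hs),
      pdx_mul (.coord i) (hs.pdy k), pdx_const_mul hs, pdx_coord]
    · ring
    · filter_upwards [hΩ.mem_nhds hx] with x' hx' using hdy x' hx' y hy i k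
  have hdyy : ∀ j, pdy j (pdy k (spray F i)) x y
      = y i * pdy j (pdy k P) x y + pdy k P x y * (if i = j then 1 else 0)
        + (if i = k then 1 else 0) * pdy j P x y := by
    intro j
    rw [pdy_congr (g := fun x y => y i * pdy k P x y + (if i = k then 1 else 0) * P x y),
      pdy_add ((SmoothAt.coord i).mul (hs.pdy k)) ((SmoothAt.const _).mul hs),
      pdy_mul (.coord i) (hs.pdy k), pdy_const_mul hs, pdy_coord]
    filter_upwards [eventually_ne_zero hy] with z hz using hdy x hx z hz i k
  -- the derivatives `P_{y^k}` are homogeneous of degree zero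
  have hE2 : ∑ j, y j * pdy j (pdy k P) x y = 0 := by
    have h : pdy k (fun x y => ∑ j, y j * pdy j P x y) x y = pdy k P x y := by
      refine pdy_congr ?_ k
      filter_upwards [eventually_ne_zero hy] with z hz using hE x hx z hz
    rw [pdy_sum_coord_mul fun j => hs.pdy j] at h
    have h' : ∀ j, pdy j (pdy k P) x y = pdy k (pdy j P) x y := fun j =>
      pdy_pdy_comm hs j k
    simp only [h']
    linarith
  have s1 : ∑ j, y j * pdx j (pdy k (spray F i)) x y
      = y i * ∑ j, y j * pdx j (pdy k P) x y
        + (if i = k then 1 else 0) * ∑ j, y j * pdx j P x y := by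
    rw [Finset.mul_sum, Finset.mul_sum, ← Finset.sum_add_distrib]
    exact Finset.sum_congr rfl fun j _ => by rw [hdxy]; ring
  have s2 : ∑ j, spray F j x y * pdy j (pdy k (spray F i)) x y
      = P x y * (y i * ∑ j, y j * pdy j (pdy k P) x y)
        + P x y * pdy k P x y * ∑ j, y j * (if i = j then 1 else 0)
        + (if i = k then 1 else 0) * P x y * ∑ j, y j * pdy j P x y := by
    simp only [Finset.mul_sum, ← Finset.sum_add_distrib]
    exact Finset.sum_congr rfl fun j _ => by rw [hdyy, hG x hx y hy]; ring
  have s3 : ∑ j, pdy j (spray F i) x y * pdy k (spray F j) x y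
      = y i * pdy k P x y * (∑ j, y j * pdy j P x y)
        + y i * P x y * (∑ j, pdy j P x y * (if j = k then 1 else 0))
        + P x y * pdy k P x y * (∑ j, y j * (if i = j then 1 else 0))
        + P x y ^ 2 * (∑ j, (if i = j then 1 else 0) * (if j = k then 1 else 0)) := by
    simp only [Finset.mul_sum, ← Finset.sum_add_distrib]
    refine Finset.sum_congr rfl fun j _ => ?_
    rw [hdy x hx y hy, hdy x hx y hy]
    ring
  have d1 : ∑ j, y j * (if i = j then (1 : ℝ) else 0) = y i := by simp
  have d2 : ∑ j, pdy j P x y * (if j = k then (1 : ℝ) else 0) = pdy k P x y := by simp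
  have d3 : ∑ j, (if i = j then (1 : ℝ) else 0) * (if j = k then 1 else 0)
      = if i = k then 1 else 0 := by simp
  rw [riemann, s1, s2, s3, d1, d2, d3, hE2, hE x hx y hy, hdx, riemannScalar, riemannCovector]
  ring

lemma pdy_riemannScalar (hP : SmoothAt P x y) (k : Fin n) :
    pdy k (riemannScalar P) x y
      = riemannCovector P k x y - 3 * (pdx k P x y - P x y * pdy k P x y) := by
  have h : pdy k (riemannScalar P) x y
      = pdy k (fun x y => P x y ^ 2 - ∑ j, y j * pdx j P x y) x y := rfl
  have h' : ∑ j, y j * pdy k (pdx j P) x y = ∑ j, y j * pdx j (pdy k P) x y :=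
    Finset.sum_congr rfl fun j _ => by rw [pdx_pdy_comm hP]
  rw [h, pdy_sub (hP.pow 2) (.sum fun j _ => (SmoothAt.coord j).mul (hP.pdx j)), pdy_sq hP,
    pdy_sum_coord_mul fun j => hP.pdx j, h', riemannCovector]
  ring

/-- The numerator of the flag curvature for `R^i_k = Ξ δ^i_k + τ_k y^i`. -/
lemma gInner_riemannVec {a : ℝ} {b : Fin n → ℝ}
    (h : ∀ i k, riemann F i k x y = a * (if i = k then 1 else 0) + b k * y i) (w : E n) :
    gInner F x y (riemannVec F x y w) w
      = a * gInner F x y w w + (∑ k, b k * w k) * gInner F x y y w := by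
  have hv : riemannVec F x y w = a • w + (∑ k, b k * w k) • y := by
    ext i
    simp [riemannVec, h, add_mul, Finset.sum_add_distrib, Finset.sum_mul, mul_right_comm]
  rw [hv, gInner_add_smul_left]

/-- The flag spanned by `y` and a vector `w + c y`, where `w ≠ 0` is `g_y`-orthogonal to `y`. -/
lemma IsFinslerMetric.linearIndependent_of_gInner_eq_zero (hF : IsFinslerMetric Ω F)
    (hΩ : IsOpen Ω) (hx : x ∈ Ω) (hy : y ≠ 0) {w : E n} (hw : w ≠ 0)
    (h : gInner F x y y w = 0) (c : ℝ) : LinearIndependent ℝ ![y, w + c • y] := by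
  have hF0 := hF.pos x hx y hy
  have key : ∀ a b : ℝ, a • y + b • w = 0 → a = 0 ∧ b = 0 := by
    intro a b hab
    have h1 := gInner_add_smul_left F x y y w y a b
    rw [hab, hF.gInner_symm hx hy w y, h, hF.gInner_self_self hΩ hx hy] at h1
    have h0 : gInner F x y 0 y = 0 := by simp [gInner]
    have ha : a = 0 := by
      rw [h0] at h1
      have : a * F x y ^ 2 = 0 := by linarith
      exact (mul_eq_zero.mp this).resolve_right (by positivity)
    refine ⟨ha, ?_⟩
    rw [ha, zero_smul, zero_add] at hab
    exact (smul_eq_zero.mp hab).resolve_right hw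
  rw [LinearIndependent.pair_iff]
  intro s t hst
  obtain ⟨h1, h2⟩ := key (s + t * c) t (by rw [← hst]; module)
  rw [h2] at h1
  exact ⟨by simpa using h1, h2⟩

/-- Strict Cauchy-Schwarz inequality: the denominator of the flag curvature is positive. -/
lemma IsFinslerMetric.flag_denom_pos (hF : IsFinslerMetric Ω F)
    (hΩ : IsOpen Ω) (hx : x ∈ Ω) {w : E n} (hw : LinearIndependent ℝ ![y, w]) :
    0 < gInner F x y y y * gInner F x y w w - gInner F x y y w ^ 2 := by
  have hy : y ≠ 0 := hw.ne_zero 0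
  have hF0 := hF.pos x hx y hy
  set v : E n := (F x y ^ 2) • w + (-gInner F x y y w) • y with hv
  have hv0 : v ≠ 0 := by
    intro h0
    have h := (LinearIndependent.pair_iff.mp hw (-gInner F x y y w) (F x y ^ 2)
      (by rw [← h0, hv]; abel)).2
    exact absurd h (by positivity)
  have h := hF.gInner_pos hx hy hv0
  have h1 : gInner F x y v v = F x y ^ 2 * (F x y ^ 2 * gInner F x y w w - gInner F x y y w ^ 2) := by
    conv_lhs => enter [4]; rw [hv]
    rw [gInner_add_smul_left, hF.gInner_symm hx hy w v, hF.gInner_symm hx hy y v, hv,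
      gInner_add_smul_left, gInner_add_smul_left, hF.gInner_self_self hΩ hx hy,
      hF.gInner_symm hx hy w y]
    ring
  rw [h1] at h
  rw [hF.gInner_self_self hΩ hx hy]
  exact pos_of_mul_pos_right h (by positivity)

/-- If all flags with flagpole `y` have curvature `lam`, then the curvature covector and scalar are
those of a metric of constant curvature. -/
lemma IsFinslerMetric.riemann_coeff_of_flagCurvature (hF : IsFinslerMetric Ω F) (hn : 2 ≤ n)
    (hΩ : IsOpen Ω) (hx : x ∈ Ω) (hy : y ≠ 0) {a lam : ℝ} {b : Fin n → ℝ}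
    (h : ∀ i k, riemann F i k x y = a * (if i = k then 1 else 0) + b k * y i)
    (hK : ∀ w : E n, LinearIndependent ℝ ![y, w] → flagCurvature F x y w = lam) :
    a = lam * F x y ^ 2 ∧ ∀ k, b k = -lam * (F x y * pdy k F x y) := by
  have hF0 := hF.pos x hx y hy
  have hK' : ∀ w : E n, LinearIndependent ℝ ![y, w] →
      a * gInner F x y w w + (∑ k, b k * w k) * gInner F x y y w
        = lam * (F x y ^ 2 * gInner F x y w w - gInner F x y y w ^ 2) := by
    intro w hw
    have hpos := hF.flag_denom_pos hΩ hx hw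
    have h1 := hK w hw
    rw [flagCurvature, div_eq_iff hpos.ne', gInner_riemannVec h, hF.gInner_self_self hΩ hx hy] at h1
    exact h1
  have hproj : ∀ v : E n, gInner F x y y (v - (gInner F x y y v / F x y ^ 2) • y) = 0 := by
    intro v
    have h1 := gInner_add_smul_left F x y v y y 1 (-(gInner F x y y v / F x y ^ 2))
    rw [hF.gInner_symm hx hy v y, hF.gInner_self_self hΩ hx hy, one_smul, neg_smul,
      ← sub_eq_add_neg, hF.gInner_symm hx hy] at h1
    rw [h1]
    field_simp
    ring
  have ha : ∀ w : E n, w ≠ 0 → gInner F x y y w = 0 → a = lam * F x y ^ 2 := by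
    intro w hw hyw
    have h1 := hK' w (by simpa using hF.linearIndependent_of_gInner_eq_zero hΩ hx hy hw hyw 0)
    have hww := hF.gInner_pos hx hy hw
    rw [hyw] at h1
    refine mul_right_cancel₀ hww.ne' ?_
    linarith
  -- the covector `b + lam g_y(y, ·)` vanishes on vectors `w + c y` with `c ≠ 0`
  have hb : ∀ w : E n, w ≠ 0 → gInner F x y y w = 0 → ∀ c : ℝ, c ≠ 0 →
      ∑ k, b k * w k + c * ∑ k, b k * y k = -lam * (c * F x y ^ 2) := by
    intro w hw hyw c hc
    have h1 := hK' _ (hF.linearIndependent_of_gInner_eq_zero hΩ hx hy hw hyw c)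
    have h2 : gInner F x y y (w + c • y) = c * F x y ^ 2 := by
      have := gInner_add_smul_left F x y w y y 1 c
      rw [hF.gInner_symm hx hy w y, hF.gInner_self_self hΩ hx hy, one_smul, hyw] at this
      rw [hF.gInner_symm hx hy, this]
      ring
    have h3 : ∑ k, b k * (w + c • y) k = ∑ k, b k * w k + c * ∑ k, b k * y k := by
      rw [Finset.mul_sum, ← Finset.sum_add_distrib]
      refine Finset.sum_congr rfl fun k _ => ?_
      simp only [PiLp.add_apply, PiLp.smul_apply, smul_eq_mul]
      ring
    rw [h2, h3, ha w hw hyw] at h1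
    refine mul_right_cancel₀ (b := c * F x y ^ 2) (by positivity) ?_
    linarith
  obtain ⟨w₀, hw₀⟩ := exists_linearIndependent_pair_of_one_lt_finrank (R := ℝ) (M := E n)
    (by simpa [Nat.lt_iff_add_one_le] using hn) hy
  set w := w₀ - (gInner F x y y w₀ / F x y ^ 2) • y with hwdef
  have hw : w ≠ 0 := by
    intro h0
    have := (LinearIndependent.pair_iff.mp hw₀ (-(gInner F x y y w₀ / F x y ^ 2)) 1
      (by rw [← h0, hwdef]; module)).2
    exact one_ne_zero this
  have hyb : ∑ k, b k * y k = -lam * F x y ^ 2 := by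
    have h1 := hb w hw (hproj w₀) 1 one_ne_zero
    have h2 := hb w hw (hproj w₀) 2 two_ne_zero
    linarith
  refine ⟨ha w hw (hproj w₀), fun k => ?_⟩
  set e : E n := EuclideanSpace.single k 1 with he
  have hbe : ∑ l, b l * e l = b k := by simp [he]
  have hge : gInner F x y y e = F x y * pdy k F x y := by
    rw [hF.gInner_self_left hΩ hx hy]
    simp [he]
  set u := e - (gInner F x y y e / F x y ^ 2) • y with hu
  have hbu : ∑ l, b l * u l = b k - gInner F x y y e / F x y ^ 2 * ∑ l, b l * y l := by
    rw [← hbe, Finset.mul_sum, ← Finset.sum_sub_distrib]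
    refine Finset.sum_congr rfl fun l _ => ?_
    simp only [hu, PiLp.sub_apply, PiLp.smul_apply, smul_eq_mul]
    ring
  have hu0 : ∑ l, b l * u l = 0 := by
    by_cases h0 : u = 0
    · simp [h0]
    · have h1 := hb u h0 (hproj e) 1 one_ne_zero
      rw [hyb] at h1
      linarith
  rw [hu0, hyb, hge] at hbu
  have : F x y * pdy k F x y / F x y ^ 2 * (-lam * F x y ^ 2)
      = -lam * (F x y * pdy k F x y) := by field_simp
  linarith

/-- A metric with spray `G^i = P y^i` has constant flag curvature `lam` if and only if
`P_{x^k} = P P_{y^k} - lam F F_{y^k}`. -/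
lemma IsFinslerMetric.hasConstFlagCurvature_iff (hF : IsFinslerMetric Ω F) (hn : 2 ≤ n)
    (hΩ : IsOpen Ω) (hP : ∀ x ∈ Ω, ∀ y, y ≠ 0 → SmoothAt P x y)
    (hG : ∀ x ∈ Ω, ∀ y, y ≠ 0 → ∀ i, spray F i x y = P x y * y i)
    (hE : ∀ x ∈ Ω, ∀ y, y ≠ 0 → ∑ j, y j * pdy j P x y = P x y) (lam : ℝ) :
    HasConstFlagCurvature Ω F lam ↔ ∀ x ∈ Ω, ∀ y, y ≠ 0 → ∀ k,
      pdx k P x y = P x y * pdy k P x y - lam * (F x y * pdy k F x y) := by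
  have hR := fun x (hx : x ∈ Ω) y (hy : y ≠ 0) => riemann_eq hΩ hP hG hE hx hy
  have hdiff : (∀ x ∈ Ω, ∀ y, y ≠ 0 → riemannScalar P x y = lam * F x y ^ 2) →
      ∀ x ∈ Ω, ∀ y, y ≠ 0 → ∀ k, riemannCovector P k x y
        - 3 * (pdx k P x y - P x y * pdy k P x y) = 2 * lam * (F x y * pdy k F x y) := by
    intro hΞ x hx y hy k
    have hs := hF.smoothAt hΩ hx hy
    rw [← pdy_riemannScalar (hP x hx y hy), pdy_congr (g := fun x y => lam * F x y ^ 2),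
      pdy_const_mul (hs.pow 2), pdy_sq hs]
    · ring
    · filter_upwards [eventually_ne_zero hy] with z hz using hΞ x hx z hz
  constructor
  · intro hK x hx y hy k
    have hcoeff := fun x (hx : x ∈ Ω) y (hy : y ≠ 0) =>
      hF.riemann_coeff_of_flagCurvature hn hΩ hx hy (hR x hx y hy) (hK x hx y)
    have h1 := hdiff (fun x hx y hy => (hcoeff x hx y hy).1) x hx y hy k
    have h2 := (hcoeff x hx y hy).2 k
    linarith
  · intro hPk x hx y w hw
    have hΞ : ∀ x ∈ Ω, ∀ y, y ≠ 0 → riemannScalar P x y = lam * F x y ^ 2 := by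
      intro x hx y hy
      have h1 : ∑ j, y j * pdx j P x y = P x y * ∑ j, y j * pdy j P x y
          - lam * F x y * ∑ j, y j * pdy j F x y := by
        simp only [Finset.mul_sum, ← Finset.sum_sub_distrib]
        exact Finset.sum_congr rfl fun j _ => by rw [hPk x hx y hy]; ring
      rw [riemannScalar, h1, hE x hx y hy, hF.sum_coord_mul_pdy hΩ hx hy]
      ring
    have hy : y ≠ 0 := hw.ne_zero 0
    have hτ : ∀ k, riemannCovector P k x y = -lam * (F x y * pdy k F x y) := by
      intro k
      have h1 := hdiff hΞ x hx y hy k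
      rw [hPk x hx y hy] at h1
      linarith
    have hτw : ∑ k, riemannCovector P k x y * w k = -lam * gInner F x y y w := by
      rw [hF.gInner_self_left hΩ hx hy, Finset.mul_sum, Finset.mul_sum]
      exact Finset.sum_congr rfl fun k _ => by rw [hτ]; ring
    have hpos := hF.flag_denom_pos hΩ hx hw
    rw [flagCurvature, div_eq_iff hpos.ne', gInner_riemannVec (hR x hx y hy), hΞ x hx y hy, hτw,
      hF.gInner_self_self hΩ hx hy]
    ring

end Curvature

/-! ### The curvature equation in terms of `F` and its derivative along lines -/

section Hamel

variable {Ω : Set (E n)} {F : E n → E n → ℝ} {x y : E n}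

/-- The left-hand side of the equation
`2 F² Q_{x^k} - 4 F Q F_{x^k} + (Q² + 4 lam F⁴) F_{y^k} = 0`, where `Q = y^j F_{x^j}`. For a
projective metric it expresses constant flag curvature `lam`. -/
def curvatureExpr (F : E n → E n → ℝ) (lam : ℝ) (k : Fin n) (x y : E n) : ℝ :=
  2 * F x y ^ 2 * pdx k (lineDeriv F) x y - 4 * F x y * lineDeriv F x y * pdx k F x y
    + (lineDeriv F x y ^ 2 + 4 * lam * F x y ^ 4) * pdy k F x y

lemma SmoothAt.curvatureExpr (hs : SmoothAt F x y) (lam : ℝ) (k : Fin n) :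
    SmoothAt (curvatureExpr F lam k) x y :=
  .add (.sub (.mul ((SmoothAt.const 2).mul (hs.pow 2)) (hs.lineDeriv.pdx k))
    (.mul (((SmoothAt.const 4).mul hs).mul hs.lineDeriv) (hs.pdx k)))
    (.mul ((hs.lineDeriv.pow 2).add ((SmoothAt.const (4 * lam)).mul (hs.pow 4))) (hs.pdy k))

/-- The first derivatives of the relation `2 F P = y^k F_{x^k}`, using Hamel's equation. -/
lemma IsProjective.projFactor_derivs (hproj : IsProjective Ω F) (hF : IsFinslerMetric Ω F)
    (hΩ : IsOpen Ω) (hx : x ∈ Ω) (hy : y ≠ 0) (k : Fin n) :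
    F x y * pdy k (projFactor F) x y + projFactor F x y * pdy k F x y = pdx k F x y ∧
    2 * (F x y * pdx k (projFactor F) x y + projFactor F x y * pdx k F x y)
      = pdx k (lineDeriv F) x y := by
  have hs := hF.smoothAt hΩ hx hy
  have hP := hF.smoothAt_projFactor hΩ hx hy
  constructor
  · have h1 : pdy k (lineDeriv F) x y
        = pdy k (fun x y => (2 * F x y) * projFactor F x y) x y := by
      refine pdy_congr ?_ k
      filter_upwards [eventually_ne_zero hy] with z hz using (hF.lineDeriv_eq hx hz).symm
    rw [pdy_mul ((SmoothAt.const 2).mul hs) hP, pdy_const_mul hs,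
      (hproj.spray_eq_and_hamel hF hΩ hx hy).2 k] at h1
    linarith
  · have h1 : pdx k (lineDeriv F) x y
        = pdx k (fun x y => (2 * F x y) * projFactor F x y) x y := by
      refine pdx_congr ?_ k
      filter_upwards [hΩ.mem_nhds hx] with z hz using (hF.lineDeriv_eq hz hy).symm
    rw [pdx_mul ((SmoothAt.const 2).mul hs) hP, pdx_const_mul hs] at h1
    linarith

lemma IsProjective.sum_coord_mul_pdy_projFactor (hproj : IsProjective Ω F)
    (hF : IsFinslerMetric Ω F) (hΩ : IsOpen Ω) (hx : x ∈ Ω) (hy : y ≠ 0) :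
    ∑ k, y k * pdy k (projFactor F) x y = projFactor F x y := by
  have h1 : F x y * ∑ k, y k * pdy k (projFactor F) x y
      + projFactor F x y * ∑ k, y k * pdy k F x y = lineDeriv F x y := by
    rw [lineDeriv]
    simp only [Finset.mul_sum, ← Finset.sum_add_distrib]
    refine Finset.sum_congr rfl fun k _ => ?_
    rw [← (hproj.projFactor_derivs hF hΩ hx hy k).1]
    ring
  rw [hF.sum_coord_mul_pdy hΩ hx hy, ← hF.lineDeriv_eq hx hy] at h1
  refine mul_left_cancel₀ (hF.pos x hx y hy).ne' ?_
  linarith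

lemma IsProjective.hasConstFlagCurvature_iff (hproj : IsProjective Ω F)
    (hF : IsFinslerMetric Ω F) (hn : 2 ≤ n) (hΩ : IsOpen Ω) (lam : ℝ) :
    HasConstFlagCurvature Ω F lam ↔
      ∀ x ∈ Ω, ∀ y, y ≠ 0 → ∀ k, curvatureExpr F lam k x y = 0 := by
  rw [hF.hasConstFlagCurvature_iff hn hΩ (fun x hx y hy => hF.smoothAt_projFactor hΩ hx hy)
    (fun x hx y hy => (hproj.spray_eq_and_hamel hF hΩ hx hy).1)
    (fun x hx y hy => hproj.sum_coord_mul_pdy_projFactor hF hΩ hx hy)]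
  refine forall₄_congr fun x hx y hy => forall_congr' fun k => ?_
  have hF0 := hF.pos x hx y hy
  obtain ⟨h1, h2⟩ := hproj.projFactor_derivs hF hΩ hx hy k
  have h : curvatureExpr F lam k x y = 4 * F x y ^ 3 * (pdx k (projFactor F) x y
      - (projFactor F x y * pdy k (projFactor F) x y - lam * (F x y * pdy k F x y))) := by
    rw [curvatureExpr, ← hF.lineDeriv_eq hx hy, ← h2, ← h1]
    ring
  rw [h, mul_eq_zero, or_iff_right (by positivity), sub_eq_zero]

end Hamel

/-! ### Functions of `|x|`, `|y|` and `⟨x, y⟩` -/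

section Invariants

variable {h : ℝ → ℝ → ℝ → ℝ} {p : ℝ × ℝ × ℝ}

lemma dr_eq_fderiv (hd : DifferentiableAt ℝ (fun q : ℝ × ℝ × ℝ => h q.1 q.2.1 q.2.2) p) :
    dr h p.1 p.2.1 p.2.2 = fderiv ℝ (fun q : ℝ × ℝ × ℝ => h q.1 q.2.1 q.2.2) p (1, 0, 0) := by
  have h1 : HasDerivAt (fun s : ℝ => ((s, p.2.1, p.2.2) : ℝ × ℝ × ℝ)) (1, 0, 0) p.1 :=
    (hasDerivAt_id _).prodMk ((hasDerivAt_const _ _).prodMk (hasDerivAt_const _ _))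
  exact (hd.hasFDerivAt.comp_hasDerivAt (f := fun s : ℝ => (s, p.2.1, p.2.2)) p.1 h1).deriv

lemma du_eq_fderiv (hd : DifferentiableAt ℝ (fun q : ℝ × ℝ × ℝ => h q.1 q.2.1 q.2.2) p) :
    du h p.1 p.2.1 p.2.2 = fderiv ℝ (fun q : ℝ × ℝ × ℝ => h q.1 q.2.1 q.2.2) p (0, 1, 0) := by
  have h1 : HasDerivAt (fun s : ℝ => ((p.1, s, p.2.2) : ℝ × ℝ × ℝ)) (0, 1, 0) p.2.1 :=
    (hasDerivAt_const _ _).prodMk ((hasDerivAt_id _).prodMk (hasDerivAt_const _ _))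
  exact (hd.hasFDerivAt.comp_hasDerivAt (f := fun s : ℝ => (p.1, s, p.2.2)) p.2.1 h1).deriv

lemma dv_eq_fderiv (hd : DifferentiableAt ℝ (fun q : ℝ × ℝ × ℝ => h q.1 q.2.1 q.2.2) p) :
    dv h p.1 p.2.1 p.2.2 = fderiv ℝ (fun q : ℝ × ℝ × ℝ => h q.1 q.2.1 q.2.2) p (0, 0, 1) := by
  have h1 : HasDerivAt (fun s : ℝ => ((p.1, p.2.1, s) : ℝ × ℝ × ℝ)) (0, 0, 1) p.2.2 :=
    (hasDerivAt_const _ _).prodMk ((hasDerivAt_const _ _).prodMk (hasDerivAt_id _))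
  exact (hd.hasFDerivAt.comp_hasDerivAt (f := fun s : ℝ => (p.1, p.2.1, s)) p.2.2 h1).deriv

lemma fderiv_apply_eq (hd : DifferentiableAt ℝ (fun q : ℝ × ℝ × ℝ => h q.1 q.2.1 q.2.2) p)
    (a b c : ℝ) :
    fderiv ℝ (fun q : ℝ × ℝ × ℝ => h q.1 q.2.1 q.2.2) p (a, b, c)
      = a * dr h p.1 p.2.1 p.2.2 + b * du h p.1 p.2.1 p.2.2 + c * dv h p.1 p.2.1 p.2.2 := by
  rw [dr_eq_fderiv hd, du_eq_fderiv hd, dv_eq_fderiv hd]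
  have : ((a, b, c) : ℝ × ℝ × ℝ) = a • (1, 0, 0) + b • (0, 1, 0) + c • (0, 0, 1) := by simp
  rw [this, map_add, map_add, map_smul, map_smul, map_smul]
  simp

lemma eventually_differentiableAt_of_contDiffAt
    (hs : ContDiffAt ℝ ∞ (fun q : ℝ × ℝ × ℝ => h q.1 q.2.1 q.2.2) p) :
    ∀ᶠ q in 𝓝 p, DifferentiableAt ℝ (fun q : ℝ × ℝ × ℝ => h q.1 q.2.1 q.2.2) q := by
  have h1 : ContDiffAt ℝ 1 (fun q : ℝ × ℝ × ℝ => h q.1 q.2.1 q.2.2) p := hs.of_le (by simp)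
  exact (h1.eventually (by simp)).mono fun p hp => hp.differentiableAt (by simp)

lemma contDiffAt_dr (hs : ContDiffAt ℝ ∞ (fun q : ℝ × ℝ × ℝ => h q.1 q.2.1 q.2.2) p) :
    ContDiffAt ℝ ∞ (fun q : ℝ × ℝ × ℝ => dr h q.1 q.2.1 q.2.2) p :=
  ((hs.fderiv_right (m := ∞) (by simp)).clm_apply contDiffAt_const).congr_of_eventuallyEq
    ((eventually_differentiableAt_of_contDiffAt hs).mono fun _ hq => dr_eq_fderiv hq)

lemma contDiffAt_du (hs : ContDiffAt ℝ ∞ (fun q : ℝ × ℝ × ℝ => h q.1 q.2.1 q.2.2) p) :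
    ContDiffAt ℝ ∞ (fun q : ℝ × ℝ × ℝ => du h q.1 q.2.1 q.2.2) p :=
  ((hs.fderiv_right (m := ∞) (by simp)).clm_apply contDiffAt_const).congr_of_eventuallyEq
    ((eventually_differentiableAt_of_contDiffAt hs).mono fun _ hq => du_eq_fderiv hq)

lemma contDiffAt_dv (hs : ContDiffAt ℝ ∞ (fun q : ℝ × ℝ × ℝ => h q.1 q.2.1 q.2.2) p) :
    ContDiffAt ℝ ∞ (fun q : ℝ × ℝ × ℝ => dv h q.1 q.2.1 q.2.2) p :=
  ((hs.fderiv_right (m := ∞) (by simp)).clm_apply contDiffAt_const).congr_of_eventuallyEq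
    ((eventually_differentiableAt_of_contDiffAt hs).mono fun _ hq => dv_eq_fderiv hq)

lemma contDiffAt_Q (hs : ContDiffAt ℝ ∞ (fun q : ℝ × ℝ × ℝ => h q.1 q.2.1 q.2.2) p)
    (hp : p.1 ≠ 0) : ContDiffAt ℝ ∞ (fun q : ℝ × ℝ × ℝ => Q h q.1 q.2.1 q.2.2) p :=
  ((contDiffAt_snd.snd.div contDiffAt_fst hp).mul (contDiffAt_dr hs)).add
    ((contDiffAt_snd.fst.pow 2).mul (contDiffAt_dv hs))

/-- The gradient of the Euclidean norm is `x / |x|`. -/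
lemma hasFDerivAt_norm_of_ne_zero {x : E n} (hx : x ≠ 0) :
    HasFDerivAt (fun z : E n => ‖z‖) (‖x‖⁻¹ • innerSL ℝ x) x := by
  have hx0 : ‖x‖ ≠ 0 := norm_ne_zero_iff.mpr hx
  have h1 := (hasStrictFDerivAt_norm_sq x).hasFDerivAt.sqrt (pow_ne_zero 2 hx0)
  simp only [Real.sqrt_sq (norm_nonneg _)] at h1
  refine h1.congr_fderiv ?_
  ext v
  simp
  field_simp

variable {f : E n → E n → ℝ} {x y : E n}

lemma pdx_of_eventually_eq
    (hd : DifferentiableAt ℝ (fun q : ℝ × ℝ × ℝ => h q.1 q.2.1 q.2.2) (‖x‖, ‖y‖, inner ℝ x y))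
    (hx : x ≠ 0) (hf : ∀ᶠ z in 𝓝 x, f z y = h ‖z‖ ‖y‖ (inner ℝ z y)) (k : Fin n) :
    pdx k f x y = dr h ‖x‖ ‖y‖ (inner ℝ x y) * (x k / ‖x‖)
      + dv h ‖x‖ ‖y‖ (inner ℝ x y) * y k := by
  have h1 := (hasFDerivAt_norm_of_ne_zero hx).prodMk ((hasFDerivAt_const ‖y‖ x).prodMk
    ((hasFDerivAt_id x).inner ℝ (hasFDerivAt_const y x)))
  have h2 : HasFDerivAt (fun z => h ‖z‖ ‖y‖ (inner ℝ z y)) _ x :=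
    hd.hasFDerivAt.comp (f := fun z : E n => (‖z‖, ‖y‖, (inner ℝ z y : ℝ))) x h1
  rw [pdx_congr (g := fun z y => h ‖z‖ ‖y‖ (inner ℝ z y)) hf, pdx, h2.fderiv]
  rw [ContinuousLinearMap.comp_apply, ContinuousLinearMap.prod_apply,
    ContinuousLinearMap.prod_apply, fderiv_apply_eq hd]
  simp [EuclideanSpace.inner_single_right, EuclideanSpace.inner_single_left]
  field_simp

lemma pdy_of_eventually_eq
    (hd : DifferentiableAt ℝ (fun q : ℝ × ℝ × ℝ => h q.1 q.2.1 q.2.2) (‖x‖, ‖y‖, inner ℝ x y))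
    (hy : y ≠ 0) (hf : ∀ᶠ z in 𝓝 y, f x z = h ‖x‖ ‖z‖ (inner ℝ x z)) (k : Fin n) :
    pdy k f x y = du h ‖x‖ ‖y‖ (inner ℝ x y) * (y k / ‖y‖)
      + dv h ‖x‖ ‖y‖ (inner ℝ x y) * x k := by
  have h1 := (hasFDerivAt_const ‖x‖ y).prodMk ((hasFDerivAt_norm_of_ne_zero hy).prodMk
    ((hasFDerivAt_const x y).inner ℝ (hasFDerivAt_id y)))
  have h2 : HasFDerivAt (fun z => h ‖x‖ ‖z‖ (inner ℝ x z)) _ y :=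
    hd.hasFDerivAt.comp (f := fun z : E n => (‖x‖, ‖z‖, (inner ℝ x z : ℝ))) y h1
  rw [pdy_congr (g := fun x z => h ‖x‖ ‖z‖ (inner ℝ x z)) hf, pdy, h2.fderiv]
  rw [ContinuousLinearMap.comp_apply, ContinuousLinearMap.prod_apply,
    ContinuousLinearMap.prod_apply, fderiv_apply_eq hd]
  simp [EuclideanSpace.inner_single_right]
  field_simp

/-- A continuous function of `(|x|, |y|, ⟨x, y⟩)` that vanishes whenever `x` and `y` are linearly
independent also vanishes at linearly dependent pairs. -/
lemma eq_zero_of_forall_linearIndependent (hn : 2 ≤ n) {g : ℝ × ℝ × ℝ → ℝ} (hx : x ≠ 0)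
    (hg : ContinuousAt g (‖x‖, ‖y‖, inner ℝ x y))
    (h0 : ∀ z : E n, LinearIndependent ℝ ![x, z] → g (‖x‖, ‖z‖, inner ℝ x z) = 0) :
    g (‖x‖, ‖y‖, inner ℝ x y) = 0 := by
  by_cases hxy : LinearIndependent ℝ ![x, y]
  · exact h0 y hxy
  rw [LinearIndependent.pair_iff' hx] at hxy
  push Not at hxy
  obtain ⟨a, rfl⟩ := hxy
  obtain ⟨w, hw⟩ := exists_linearIndependent_pair_of_one_lt_finrank (R := ℝ) (M := E n)
    (by simpa [Nat.lt_iff_add_one_le] using hn) hx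
  have hind : ∀ t : ℝ, t ≠ 0 → LinearIndependent ℝ ![x, a • x + t • w] := by
    intro t ht
    rw [LinearIndependent.pair_iff]
    intro s b hsb
    obtain ⟨h1, h2⟩ := LinearIndependent.pair_iff.mp hw (s + b * a) (b * t)
      (by rw [← hsb]; module)
    have hb : b = 0 := (mul_eq_zero.mp h2).resolve_right ht
    exact ⟨by simpa [hb] using h1, hb⟩
  let γ : ℝ → ℝ × ℝ × ℝ := fun t => (‖x‖, ‖a • x + t • w‖, inner ℝ x (a • x + t • w))
  have hγ : ContinuousAt γ 0 := by fun_prop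
  have hγ0 : γ 0 = (‖x‖, ‖a • x‖, inner ℝ x (a • x)) := by simp [γ]
  have hlim : Tendsto (fun t => g (γ t)) (𝓝[≠] 0) (𝓝 (g (γ 0))) :=
    (ContinuousAt.comp (hγ0 ▸ hg) hγ).tendsto.mono_left nhdsWithin_le_nhds
  rw [← hγ0]
  refine tendsto_nhds_unique hlim (tendsto_const_nhds.congr' ?_)
  filter_upwards [self_mem_nhdsWithin] with t ht using (h0 _ (hind t ht)).symm

end Invariants

/-! ### The curvature equations for `φ` -/

section SphericallySymmetric

variable {Ω : Set (E n)} {F : E n → E n → ℝ} {φ : ℝ → ℝ → ℝ → ℝ} {x y : E n}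

/-- The left-hand side of the first curvature equation for `φ`. -/
def curvatureEqU (φ : ℝ → ℝ → ℝ → ℝ) (lam r u v : ℝ) : ℝ :=
  4 * lam * r * φ r u v ^ 4 * du φ r u v + r * du φ r u v * Q φ r u v ^ 2
    - 4 * r * u * φ r u v * dv φ r u v * Q φ r u v + 4 * u * φ r u v ^ 2 * dr φ r u v

/-- The left-hand side of the second curvature equation for `φ`. -/
def curvatureEqV (φ : ℝ → ℝ → ℝ → ℝ) (lam r u v : ℝ) : ℝ :=
  4 * lam * r * φ r u v ^ 4 * dv φ r u v + r * dv φ r u v * Q φ r u v ^ 2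
    + 2 * φ r u v ^ 2 * dr (Q φ) r u v - 4 * φ r u v * dr φ r u v * Q φ r u v

section Continuity

variable {p : ℝ × ℝ × ℝ}

lemma continuousAt_curvatureEqU (hs : ContDiffAt ℝ ∞ (fun q : ℝ × ℝ × ℝ => φ q.1 q.2.1 q.2.2) p)
    (hp : p.1 ≠ 0) (lam : ℝ) :
    ContinuousAt (fun q : ℝ × ℝ × ℝ => curvatureEqU φ lam q.1 q.2.1 q.2.2) p := by
  have h0 := hs.continuousAt
  have h1 := (contDiffAt_dr hs).continuousAt
  have h2 := (contDiffAt_du hs).continuousAt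
  have h3 := (contDiffAt_dv hs).continuousAt
  have h4 := (contDiffAt_Q hs hp).continuousAt
  unfold curvatureEqU
  fun_prop

lemma continuousAt_curvatureEqV (hs : ContDiffAt ℝ ∞ (fun q : ℝ × ℝ × ℝ => φ q.1 q.2.1 q.2.2) p)
    (hp : p.1 ≠ 0) (lam : ℝ) :
    ContinuousAt (fun q : ℝ × ℝ × ℝ => curvatureEqV φ lam q.1 q.2.1 q.2.2) p := by
  have h0 := hs.continuousAt
  have h1 := (contDiffAt_dr hs).continuousAt
  have h3 := (contDiffAt_dv hs).continuousAt
  have h4 := (contDiffAt_Q hs hp).continuousAt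
  have h5 := (contDiffAt_dr (contDiffAt_Q hs hp)).continuousAt
  unfold curvatureEqV
  fun_prop

lemma continuousAt_mul_dv_Q_sub (hs : ContDiffAt ℝ ∞ (fun q : ℝ × ℝ × ℝ => φ q.1 q.2.1 q.2.2) p)
    (hp : p.1 ≠ 0) :
    ContinuousAt (fun q : ℝ × ℝ × ℝ =>
      q.1 * dv (Q φ) q.1 q.2.1 q.2.2 - 2 * dr φ q.1 q.2.1 q.2.2) p := by
  have h1 := (contDiffAt_dr hs).continuousAt
  have h5 := (contDiffAt_dv (contDiffAt_Q hs hp)).continuousAt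
  fun_prop

end Continuity

/-- `F(x, y) = φ(|x|, |y|, ⟨x, y⟩)` on `Ω`, with `φ` smooth at the values of its arguments for
`x ≠ 0`. -/
structure IsRepresentedBy (Ω : Set (E n)) (F : E n → E n → ℝ) (φ : ℝ → ℝ → ℝ → ℝ) : Prop where
  smooth : ∀ p ∈ ruvDomain Ω, ContDiffAt ℝ ∞ (fun q : ℝ × ℝ × ℝ => φ q.1 q.2.1 q.2.2) p
  eq : ∀ x ∈ Ω, ∀ y, y ≠ 0 → F x y = φ ‖x‖ ‖y‖ (inner ℝ x y)

namespace IsRepresentedBy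

lemma contDiffAt (h : IsRepresentedBy Ω F φ) (hx : x ∈ Ω) (hx0 : x ≠ 0) (hy : y ≠ 0) :
    ContDiffAt ℝ ∞ (fun q : ℝ × ℝ × ℝ => φ q.1 q.2.1 q.2.2) (‖x‖, ‖y‖, inner ℝ x y) :=
  h.smooth _ ⟨x, hx, hx0, y, hy, rfl⟩

lemma pdx_eq (h : IsRepresentedBy Ω F φ) (hΩ : IsOpen Ω) (hx : x ∈ Ω) (hx0 : x ≠ 0) (hy : y ≠ 0)
    (k : Fin n) :
    pdx k F x y = dr φ ‖x‖ ‖y‖ (inner ℝ x y) * (x k / ‖x‖)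
      + dv φ ‖x‖ ‖y‖ (inner ℝ x y) * y k := by
  refine pdx_of_eventually_eq ((h.contDiffAt hx hx0 hy).differentiableAt (by simp)) hx0 ?_ k
  filter_upwards [hΩ.mem_nhds hx] with z hz using h.eq z hz y hy

lemma pdy_eq (h : IsRepresentedBy Ω F φ) (hx : x ∈ Ω) (hx0 : x ≠ 0) (hy : y ≠ 0) (k : Fin n) :
    pdy k F x y = du φ ‖x‖ ‖y‖ (inner ℝ x y) * (y k / ‖y‖)
      + dv φ ‖x‖ ‖y‖ (inner ℝ x y) * x k := by
  refine pdy_of_eventually_eq ((h.contDiffAt hx hx0 hy).differentiableAt (by simp)) hy ?_ k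
  filter_upwards [eventually_ne_zero hy] with z hz using h.eq x hx z hz

lemma lineDeriv_eq (h : IsRepresentedBy Ω F φ) (hΩ : IsOpen Ω) (hx : x ∈ Ω) (hx0 : x ≠ 0)
    (hy : y ≠ 0) : lineDeriv F x y = Q φ ‖x‖ ‖y‖ (inner ℝ x y) := by
  have h1 : (inner ℝ x y : ℝ) = ∑ k, y k * x k := by simp [PiLp.inner_apply]
  have h2 : ‖y‖ ^ 2 = ∑ k, y k * y k := by
    rw [EuclideanSpace.real_norm_sq_eq]
    simp only [pow_two]
  have h3 : lineDeriv F x y = (∑ k, y k * x k) / ‖x‖ * dr φ ‖x‖ ‖y‖ (inner ℝ x y)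
      + (∑ k, y k * y k) * dv φ ‖x‖ ‖y‖ (inner ℝ x y) := by
    rw [lineDeriv, Finset.sum_div, Finset.sum_mul, Finset.sum_mul, ← Finset.sum_add_distrib]
    refine Finset.sum_congr rfl fun k _ => ?_
    rw [h.pdx_eq hΩ hx hx0 hy]
    ring
  rw [h3, ← h1, ← h2, Q]

lemma contDiffAt_Q (h : IsRepresentedBy Ω F φ) (hx : x ∈ Ω) (hx0 : x ≠ 0) (hy : y ≠ 0) :
    ContDiffAt ℝ ∞ (fun q : ℝ × ℝ × ℝ => Q φ q.1 q.2.1 q.2.2) (‖x‖, ‖y‖, inner ℝ x y) :=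
  Finsler.contDiffAt_Q (h.contDiffAt hx hx0 hy) (norm_ne_zero_iff.mpr hx0)

lemma pdx_lineDeriv_eq (h : IsRepresentedBy Ω F φ) (hΩ : IsOpen Ω) (hx : x ∈ Ω) (hx0 : x ≠ 0)
    (hy : y ≠ 0) (k : Fin n) :
    pdx k (lineDeriv F) x y = dr (Q φ) ‖x‖ ‖y‖ (inner ℝ x y) * (x k / ‖x‖)
      + dv (Q φ) ‖x‖ ‖y‖ (inner ℝ x y) * y k := by
  refine pdx_of_eventually_eq ((h.contDiffAt_Q hx hx0 hy).differentiableAt (by simp)) hx0 ?_ k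
  filter_upwards [hΩ.mem_nhds hx, eventually_ne_zero hx0] with z hz hz0
    using h.lineDeriv_eq hΩ hz hz0 hy

lemma pdy_lineDeriv_eq (h : IsRepresentedBy Ω F φ) (hΩ : IsOpen Ω) (hx : x ∈ Ω) (hx0 : x ≠ 0)
    (hy : y ≠ 0) (k : Fin n) :
    pdy k (lineDeriv F) x y = du (Q φ) ‖x‖ ‖y‖ (inner ℝ x y) * (y k / ‖y‖)
      + dv (Q φ) ‖x‖ ‖y‖ (inner ℝ x y) * x k := by
  refine pdy_of_eventually_eq ((h.contDiffAt_Q hx hx0 hy).differentiableAt (by simp)) hy ?_ k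
  filter_upwards [eventually_ne_zero hy] with z hz using h.lineDeriv_eq hΩ hx hx0 hz

end IsRepresentedBy

lemma eq_zero_of_forall_coord_add {a b : ℝ} (hxy : LinearIndependent ℝ ![x, y])
    (h : ∀ k, a * x k + b * y k = 0) : a = 0 ∧ b = 0 := by
  refine LinearIndependent.pair_iff.mp hxy a b ?_
  ext k
  simpa using h k

/-- The `x`-component `r Q_v = 2 φ_r` of Hamel's equation for a spherically symmetric metric. -/
lemma IsProjective.norm_mul_dv_Q (hproj : IsProjective Ω F) (hF : IsFinslerMetric Ω F)
    (hn : 2 ≤ n) (hΩ : IsOpen Ω) (h : IsRepresentedBy Ω F φ) (hx : x ∈ Ω) (hx0 : x ≠ 0)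
    (hy : y ≠ 0) :
    ‖x‖ * dv (Q φ) ‖x‖ ‖y‖ (inner ℝ x y) - 2 * dr φ ‖x‖ ‖y‖ (inner ℝ x y) = 0 := by
  have hr : ‖x‖ ≠ 0 := norm_ne_zero_iff.mpr hx0
  refine eq_zero_of_forall_linearIndependent hn
    (g := fun q => q.1 * dv (Q φ) q.1 q.2.1 q.2.2 - 2 * dr φ q.1 q.2.1 q.2.2) hx0
    (continuousAt_mul_dv_Q_sub (h.contDiffAt hx hx0 hy) hr) fun z hxz => ?_
  have hz : z ≠ 0 := hxz.ne_zero 1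
  have h1 := fun k => (hproj.spray_eq_and_hamel hF hΩ hx hz).2 k
  simp only [h.pdy_lineDeriv_eq hΩ hx hx0 hz, h.pdx_eq hΩ hx hx0 hz] at h1
  have h2 := (eq_zero_of_forall_coord_add
    (a := dv (Q φ) ‖x‖ ‖z‖ (inner ℝ x z) - 2 * dr φ ‖x‖ ‖z‖ (inner ℝ x z) / ‖x‖)
    (b := du (Q φ) ‖x‖ ‖z‖ (inner ℝ x z) / ‖z‖ - 2 * dv φ ‖x‖ ‖z‖ (inner ℝ x z)) hxz
    fun k => by linear_combination h1 k).1
  field_simp at h2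
  linarith

/-- For `x ≠ 0` the curvature expression of `F` is a combination of `x` and `y` whose coefficients
are the curvature expressions of `φ`. -/
lemma IsProjective.curvatureExpr_eq (hproj : IsProjective Ω F) (hF : IsFinslerMetric Ω F)
    (hn : 2 ≤ n) (hΩ : IsOpen Ω) (h : IsRepresentedBy Ω F φ) (hx : x ∈ Ω) (hx0 : x ≠ 0)
    (hy : y ≠ 0) (lam : ℝ) (k : Fin n) :
    curvatureExpr F lam k x y
      = curvatureEqV φ lam ‖x‖ ‖y‖ (inner ℝ x y) / ‖x‖ * x k
        + curvatureEqU φ lam ‖x‖ ‖y‖ (inner ℝ x y) / (‖x‖ * ‖y‖) * y k := by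
  have hr : ‖x‖ ≠ 0 := norm_ne_zero_iff.mpr hx0
  have hu : ‖y‖ ≠ 0 := norm_ne_zero_iff.mpr hy
  have hQv : dv (Q φ) ‖x‖ ‖y‖ (inner ℝ x y) = 2 * dr φ ‖x‖ ‖y‖ (inner ℝ x y) / ‖x‖ := by
    have := hproj.norm_mul_dv_Q hF hn hΩ h hx hx0 hy
    field_simp
    linarith
  rw [curvatureExpr, h.pdx_lineDeriv_eq hΩ hx hx0 hy, h.pdx_eq hΩ hx hx0 hy, h.pdy_eq hx hx0 hy,
    h.lineDeriv_eq hΩ hx hx0 hy, h.eq x hx y hy, hQv, curvatureEqU, curvatureEqV]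
  field_simp
  ring

/-- The curvature expression of `F` vanishes everywhere if it does so over the points `x ≠ 0`. -/
lemma IsFinslerMetric.curvatureExpr_eq_zero (hF : IsFinslerMetric Ω F) (hΩ : IsOpen Ω) {lam : ℝ}
    {k : Fin n} (h : ∀ x ∈ Ω, x ≠ 0 → ∀ y, y ≠ 0 → curvatureExpr F lam k x y = 0)
    (hx : x ∈ Ω) (hy : y ≠ 0) : curvatureExpr F lam k x y = 0 := by
  by_cases hx0 : x ≠ 0
  · exact h x hx hx0 y hy
  push Not at hx0
  subst hx0
  let γ : ℝ → E n × E n := fun t => (t • y, y)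
  have hγ : ContinuousAt γ 0 := by fun_prop
  have hγ0 : γ 0 = (0, y) := by simp [γ]
  have hc := ((hF.smoothAt hΩ hx hy).curvatureExpr lam k).continuousAt
  have hlim : Tendsto (fun t => curvatureExpr F lam k (γ t).1 (γ t).2) (𝓝[≠] 0)
      (𝓝 (curvatureExpr F lam k (γ 0).1 (γ 0).2)) :=
    (ContinuousAt.comp (g := fun p : E n × E n => curvatureExpr F lam k p.1 p.2) (hγ0 ▸ hc)
      hγ).tendsto.mono_left nhdsWithin_le_nhds
  rw [hγ0] at hlim
  refine tendsto_nhds_unique hlim (tendsto_const_nhds.congr' ?_)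
  have hmem : ∀ᶠ t in 𝓝[≠] (0 : ℝ), t • y ∈ Ω := by
    refine nhdsWithin_le_nhds ?_
    have h1 : ContinuousAt (fun t : ℝ => t • y) 0 := by fun_prop
    exact h1 (hΩ.mem_nhds (by simpa using hx))
  filter_upwards [hmem, self_mem_nhdsWithin] with t ht ht0
  exact (h _ ht (smul_ne_zero ht0 hy) y hy).symm

end SphericallySymmetric

end Finsler
end

theorem theorem4p4 (n : ℕ) (hn : 2 ≤ n) (Ω : Set (Finsler.E n))
    (hΩo : IsOpen Ω) (hΩc : Convex ℝ Ω)
    (F : Finsler.E n → Finsler.E n → ℝ) (hF : Finsler.IsFinslerMetric Ω F)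
    (hsym : Finsler.IsSphericallySymmetric Ω F)
    (φ : ℝ → ℝ → ℝ → ℝ)
    (hφ : ∀ p ∈ Finsler.ruvDomain Ω,
      ContDiffAt ℝ ∞ (fun q : ℝ × ℝ × ℝ => φ q.1 q.2.1 q.2.2) p)
    (hFφ : ∀ x ∈ Ω, ∀ y, y ≠ 0 → F x y = φ ‖x‖ ‖y‖ (inner ℝ x y))
    (hproj : Finsler.IsProjective Ω F) (lam : ℝ) :
    Finsler.HasConstFlagCurvature Ω F lam ↔
      ∀ r u v : ℝ, (r, u, v) ∈ Finsler.ruvDomain Ω →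
        4 * lam * r * φ r u v ^ 4 * Finsler.du φ r u v
            + r * Finsler.du φ r u v * Finsler.Q φ r u v ^ 2
            - 4 * r * u * φ r u v * Finsler.dv φ r u v * Finsler.Q φ r u v
            + 4 * u * φ r u v ^ 2 * Finsler.dr φ r u v = 0 ∧
        4 * lam * r * φ r u v ^ 4 * Finsler.dv φ r u v
            + r * Finsler.dv φ r u v * Finsler.Q φ r u v ^ 2
            + 2 * φ r u v ^ 2 * Finsler.dr (Finsler.Q φ) r u v
            - 4 * φ r u v * Finsler.dr φ r u v * Finsler.Q φ r u v = 0 := by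
  have h : Finsler.IsRepresentedBy Ω F φ := ⟨hφ, hFφ⟩
  rw [hproj.hasConstFlagCurvature_iff hF hn hΩo lam]
  change _ ↔ ∀ r u v : ℝ, (r, u, v) ∈ Finsler.ruvDomain Ω →
    Finsler.curvatureEqU φ lam r u v = 0 ∧ Finsler.curvatureEqV φ lam r u v = 0
  constructor
  · rintro hcurv r u v ⟨x, hx, hx0, y, hy, heq⟩
    obtain ⟨rfl, rfl, rfl⟩ : r = ‖x‖ ∧ u = ‖y‖ ∧ v = inner ℝ x y := by simpa using heq
    have hr : ‖x‖ ≠ 0 := norm_ne_zero_iff.mpr hx0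
    -- at linearly independent `x, z` both coefficients of `curvatureExpr` vanish
    have hind : ∀ z : Finsler.E n, LinearIndependent ℝ ![x, z] →
        Finsler.curvatureEqU φ lam ‖x‖ ‖z‖ (inner ℝ x z) = 0 ∧
          Finsler.curvatureEqV φ lam ‖x‖ ‖z‖ (inner ℝ x z) = 0 := by
      intro z hxz
      have hz : z ≠ 0 := hxz.ne_zero 1
      have hu : ‖z‖ ≠ 0 := norm_ne_zero_iff.mpr hz
      obtain ⟨h1, h2⟩ := Finsler.eq_zero_of_forall_coord_add hxz fun k =>
        (hproj.curvatureExpr_eq hF hn hΩo h hx hx0 hz lam k).symm.trans (hcurv x hx z hz k)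
      exact ⟨(div_eq_zero_iff.mp h2).resolve_right (mul_ne_zero hr hu),
        (div_eq_zero_iff.mp h1).resolve_right hr⟩
    have hs := h.contDiffAt hx hx0 hy
    exact ⟨Finsler.eq_zero_of_forall_linearIndependent hn
        (g := fun q => Finsler.curvatureEqU φ lam q.1 q.2.1 q.2.2) hx0
        (Finsler.continuousAt_curvatureEqU hs hr lam) fun z hz => (hind z hz).1,
      Finsler.eq_zero_of_forall_linearIndependent hn
        (g := fun q => Finsler.curvatureEqV φ lam q.1 q.2.1 q.2.2) hx0
        (Finsler.continuousAt_curvatureEqV hs hr lam) fun z hz => (hind z hz).2⟩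
  · intro hφeq x hx y hy k
    refine hF.curvatureExpr_eq_zero hΩo (fun x hx hx0 y hy => ?_) hx hy
    obtain ⟨h1, h2⟩ := hφeq _ _ _ ⟨x, hx, hx0, y, hy, rfl⟩
    rw [hproj.curvatureExpr_eq hF hn hΩo h hx hx0 hy, h1, h2]
    simp
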